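/- For $r\ge 2$ the generalised star $St_r(d_1,\dots,d_{r-1})$ is defined recursively: $St_2(d)$ is the star with $d$ leaves, and $St_r(d_1,\dots,d_{r-1})$ is the $r$-graph ($r$-uniform hypergraph) in which all edges have one vertex $v$ in common and such that removing $v$ from every edge leaves $d_1$ vertex-disjoint copies of $St_{r-1}(d_2,\dots,d_{r-1})$. An $r$-graph $H$ is $(n,e)$-unavoidable if every $r$-graph with $n$ vertices and $e$ edges contains a copy of $H$ (as a not necessarily induced subgraph). For positive integers $n,k$ put $$d=(n/k)^{1/3},\qquad t=\min\{k,d^{1/4}\}.$$ Theorem. There is an absolute constant $C>0$ such that the following hold. (a) For all positive integers $n,k$, every $4$-graph with $n$ vertices and at least $Ckn^3$ edges contains $\lceil t\rceil$ pairwise vertex-disjoint copies of $St_4(\lceil d\rceil,\lceil d\rceil,k)$. (b) These are optimal unavoidable $4$-graphs, up to a constant factor, in the dense regime. That is, for all $\varepsilon>0$ and $K$ there is a constant $C'>0$ such that for all positive integers $n,k$ and every integer $e$ with $$Ckn^3\le e\le Kkn^3,\qquad e\le n^{4-\varepsilon},\qquad e\le\binom n4,$$ the vertex-disjoint union $S$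 of $\lceil t\rceil$ copies of $St_4(\lceil d\rceil,\lceil d\rceil,k)$ is $(n,e)$-unavoidable, and every $(n,e)$-unavoidable $4$-graph $H$ satisfies $|E(H)|\le C'\,|E(S)|$. -/

import Mathlib

/-- A (finite) `r`-graph, i.e. an `r`-uniform hypergraph, whose vertex set is the whole type `V`. -/
structure RGraph (r : ℕ) (V : Type*) where
  /-- the set of edges -/
  edges : Finset (Finset V)
  /-- every edge consists of exactly `r` vertices -/
  uniform : ∀ e ∈ edges, e.card = r

namespace RGraph

variable {r : ℕ} {V W : Type*}

/-- The injective map `f` from the vertices of `H` to those of `G` is a copy of `H` in `G`: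
it sends every edge of `H` to an edge of `G`. -/
def IsCopy (H : RGraph r W) (G : RGraph r V) (f : W ↪ V) : Prop :=
  ∀ e ∈ H.edges, e.map f ∈ G.edges

/-- `G` contains a copy of `H` (as a not necessarily induced subgraph). -/
def Contains (G : RGraph r V) (H : RGraph r W) : Prop :=
  ∃ f : W ↪ V, IsCopy H G f

/-- `G` contains `m` pairwise vertex-disjoint copies of `H`. -/
def ContainsDisjoint (G : RGraph r V) (m : ℕ) (H : RGraph r W) : Prop :=
  ∃ f : Fin m → (W ↪ V), (∀ i, IsCopy H G (f i)) ∧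
    Pairwise fun i j => Disjoint (Set.range (f i)) (Set.range (f j))

open Classical in
/-- The vertex-disjoint union of `m` copies of `H`; the `i`-th copy lives on the vertices
`(i, x)`, where `x` is a vertex of `H`. -/
noncomputable def copies (m : ℕ) (H : RGraph r W) : RGraph r (Fin m × W) where
  edges := Finset.univ.biUnion fun i : Fin m =>
    H.edges.image fun e => e.map ⟨Prod.mk i, Prod.mk_right_injective i⟩
  uniform := by
    intro e he
    simp only [Finset.mem_biUnion, Finset.mem_univ, true_and, Finset.mem_image] at he
    obtain ⟨i, a, ha, rfl⟩ := he
    rw [Finset.card_map]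
    exact H.uniform a ha

/-- Add one new vertex `none` to `H` and put it into every edge. -/
def cone (H : RGraph r W) : RGraph (r + 1) (Option W) where
  edges := H.edges.map Finset.insertNone.toEmbedding
  uniform := by
    intro e he
    simp only [Finset.mem_map] at he
    obtain ⟨a, ha, rfl⟩ := he
    have h := Finset.card_insertNone a
    rw [H.uniform a ha] at h
    exact h

/-- The vertices of a generalised star: the root `none`, and then the vertices of
the `d₁` smaller generalised stars. -/
abbrev StarVertex : List ℕ → Type
  | [] => Unit
  | d :: ds => Option (Fin d × StarVertex ds)

/-- The generalised star `St_r(d₁, …, d_{r-1})`: all edges have the root in common, and removing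
the root from every edge leaves `d₁` vertex-disjoint copies of `St_{r-1}(d₂, …, d_{r-1})`.
The recursion starts from the `1`-graph with a single vertex which is also its only edge, so that
`St_2(d)` is the usual star with `d` leaves. -/
noncomputable def genStar : (ds : List ℕ) → RGraph (ds.length + 1) (StarVertex ds)
  | [] => ⟨{{()}}, by intro e he; rw [Finset.mem_singleton.mp he]; rfl⟩
  | d :: ds => cone (copies d (genStar ds))

/-- The `4`-uniform generalised star `St_4(d₁, d₂, d₃)`. -/
noncomputable def St4 (d₁ d₂ d₃ : ℕ) : RGraph 4 (StarVertex [d₁, d₂, d₃]) :=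
  genStar [d₁, d₂, d₃]

/-- `H` is `(n, e)`-unavoidable: every `r`-graph with `n` vertices and `e` edges contains a copy
of `H`. -/
def IsUnavoidable (n e : ℕ) (H : RGraph r W) : Prop :=
  ∀ G : RGraph r (Fin n), G.edges.card = e → G.Contains H

end RGraph

/-! ### Levels of a generalised star -/

namespace RGraph

/-! Part (a). Let Ω be the set of orderings of edges. For ω in Ω and a set S of positions, consider
the class of all tuples in Ω agreeing with ω on S, and let D(S) be the logarithm of (class size) ·
n^|S| / |Ω|. Disjoint stars can be embedded greedily, one vertex at a time, if at each stage a
vertex usable at a given level lies in at most a proportion q / (number of vertices to be placed at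
that level) of the available tuples. Then all vertices placed so far block a small proportion, and
averaging supplies the next vertex (`exists_disjoint_copies`). As n is about d^3 k, these conditions
follow from upper bounds on increments of D in terms of l = log d, κ = log k and θ = log (d/t), up
to constants; the bounds are collected in `NiceOrder`.

For at least half of the ω, D is supermodular up to an additive constant
(`half_le_card_nearSupermodular`). This is a pointwise analogue of the submodularity of entropy,
proved by double counting and Markov's inequality. The number of edges gives D ≤ 3l on the set of
all positions. From this alone, a case analysis (`exists_niceOrder`) finds a suitable order of the
four positions, provided that 3l ≤ 4θ and l ≤ θ + κ. Up to constants these say t ≤ d^(1/4) and t ≤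
k, which explains the choice of t. Since Ω is closed under permuting positions, a constant
proportion of it is good in the standard order; colouring and pruning retain a constant proportion
and make the degree conditions hereditary.

Part (b). Comparison with special host graphs bounds the number of non-isolated vertices of an
unavoidable H by O(t d^2 k), the order of |E(S)| (`IsUnavoidable.card_support_le`). A random
partition of all 4-sets into about n^4/e colour classes shows that H has O(1/ε) edges per such
vertex, up to an additive constant (`IsUnavoidable.card_edges_le`). -/

instance StarVertex.instFintype : (ds : List ℕ) → Fintype (StarVertex ds)
  | [] => inferInstanceAs (Fintype Unit)
  | d :: ds =>
    have := StarVertex.instFintype ds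
    inferInstanceAs (Fintype (Option (Fin d × StarVertex ds)))

/-- The distance of a vertex of a generalised star from the root. -/
def StarVertex.level : (ds : List ℕ) → StarVertex ds → ℕ
  | [], _ => 0
  | _ :: _, none => 0
  | _ :: ds, some (_, y) => StarVertex.level ds y + 1

theorem StarVertex.level_le (ds : List ℕ) (y : StarVertex ds) :
    StarVertex.level ds y ≤ ds.length := by
  induction ds with
  | nil => simp [StarVertex.level]
  | cons d ds ih =>
    rcases y with _ | ⟨i, y⟩
    · simp [StarVertex.level]
    · simpa [StarVertex.level] using ih y

/-- Level j has as many vertices as the product of the first j parameters, so each of the `ds.length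
+ 1` levels contributes at most 1. A zero parameter costs equality, not the bound. -/
theorem StarVertex.sum_inv_take_prod_le (ds : List ℕ) :
    ∑ y : StarVertex ds, ((((ds.take (StarVertex.level ds y)).prod : ℕ) : ℝ))⁻¹
      ≤ ds.length + 1 := by
  induction ds with
  | nil => simp [StarVertex.level]
  | cons d ds ih =>
    have h : ∑ y : StarVertex (d :: ds),
        (((((d :: ds).take (StarVertex.level (d :: ds) y)).prod : ℕ) : ℝ))⁻¹ =
        1 + ∑ p : Fin d × StarVertex ds,
          (((d * (ds.take (StarVertex.level ds p.2)).prod : ℕ) : ℝ))⁻¹ := by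
      refine (Fintype.sum_option (α := Fin d × StarVertex ds) _).trans ?_
      simp [StarVertex.level]
    rw [h, Fintype.sum_prod_type]
    simp only [Nat.cast_mul, mul_inv, ← Finset.mul_sum, Finset.sum_const, Finset.card_univ,
      Fintype.card_fin, nsmul_eq_mul, List.length_cons, Nat.cast_add, Nat.cast_one]
    set s := ∑ y : StarVertex ds, ((((ds.take (StarVertex.level ds y)).prod : ℕ) : ℝ))⁻¹
    have hs : 0 ≤ s := Finset.sum_nonneg fun _ _ => by positivity
    have : (d : ℝ) * ((d : ℝ)⁻¹ * s) ≤ s := by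
      rw [← mul_assoc]
      exact mul_le_of_le_one_left hs (mul_inv_le_one)
    linarith

/-! ### Greedy embedding of disjoint generalised stars -/

section Greedy

open Classical

variable {Ω V : Type*} (c : ℕ → Ω → V)

/-- The family `F` of edges, with coordinates `c off, c (off + 1), …`, is spread out enough to
embed generalised stars greedily. -/
noncomputable def Spread (q : ℝ) : List ℕ → ℕ → Finset Ω → Prop
  | [], _, _ => True
  | m :: ms, off, F =>
    (∀ j ≤ ms.length, ∀ v,
      ((F.filter fun ω => c (off + j) ω = v).card : ℝ) * (((m :: ms).take (j + 1)).prod : ℕ)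
        ≤ q * F.card) ∧
    ∀ u, (F.filter fun ω => c off ω = u).Nonempty →
      Spread q ms (off + 1) (F.filter fun ω => c off ω = u)

/-- The members of `F` with a coordinate in `[a, b)` that lies in `U`. -/
noncomputable def blocked (a b : ℕ) (U : Finset V) (F : Finset Ω) : Finset Ω :=
  F.filter fun ω => ∃ i, a ≤ i ∧ i < b ∧ c i ω ∈ U

/-- A copy of a generalised star that avoids `U`, has its edges in `F`, and respects colours. -/
structure GoodCopy (χ : V → ℕ) (a b : ℕ) (U : Finset V) (F : Finset Ω) (ds : List ℕ)
    (g : StarVertex ds ↪ V) : Prop where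
  avoid : ∀ y, g y ∉ U
  colour : ∀ y, χ (g y) = a + StarVertex.level ds y
  edge : ∀ e ∈ (genStar ds).edges, ∃ ω ∈ F, e.map g = (Finset.Ico a b).image fun i => c i ω

variable {c}

theorem GoodCopy.mono {χ : V → ℕ} {a b : ℕ} {U U' : Finset V} {F F' : Finset Ω} {ds : List ℕ}
    {g : StarVertex ds ↪ V} (h : GoodCopy c χ a b U F ds g) (hU : U' ⊆ U) (hF : F ⊆ F') :
    GoodCopy c χ a b U' F' ds g :=
  ⟨fun y hy => h.avoid y (hU hy), h.colour, fun e he =>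
    let ⟨ω, hω, h'⟩ := h.edge e he; ⟨ω, hF hω, h'⟩⟩

/-- The colouring fixes the coordinate in which a vertex x can occur, so x blocks only the members
of a single fibre. -/
theorem card_blocked_union_le {χ : V → ℕ} {b : ℕ} {F : Finset Ω}
    (hχ : ∀ ω ∈ F, ∀ i < b, χ (c i ω) = i) (a : ℕ) (U X : Finset V) :
    ((blocked c a b (U ∪ X) F).card : ℝ) ≤ (blocked c a b U F).card +
      ∑ x ∈ X, ((F.filter fun ω => c (χ x) ω = x).card : ℝ) := by
  have hsub : blocked c a b (U ∪ X) F ⊆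
      blocked c a b U F ∪ X.biUnion fun x => F.filter fun ω => c (χ x) ω = x := by
    intro ω hω
    simp only [blocked, Finset.mem_filter, Finset.mem_union, Finset.mem_biUnion] at hω ⊢
    obtain ⟨hF, i, hai, hib, hU | hX⟩ := hω
    · exact Or.inl ⟨hF, i, hai, hib, hU⟩
    · refine Or.inr ⟨c i ω, hX, hF, ?_⟩
      rw [hχ ω hF i hib]
  have h1 := (Finset.card_le_card hsub).trans (Finset.card_union_le _ _)
  have h2 : (X.biUnion fun x => F.filter fun ω => c (χ x) ω = x).card ≤
    ∑ x ∈ X, (F.filter fun ω => c (χ x) ω = x).card := Finset.card_biUnion_le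
  exact_mod_cast h1.trans (Nat.add_le_add_left h2 _)

/-- Averaging over the values of coordinate `a` gives a fibre with blocked proportion at most β. Its
value avoids `U`, since otherwise the whole fibre would be blocked and β < 1 would fail. -/
theorem exists_fibre_blocked_le {a b : ℕ} (hab : a < b) {U : Finset V} {F : Finset Ω}
    (hF : F.Nonempty) {β : ℝ} (hβ : β < 1) (h : ((blocked c a b U F).card : ℝ) ≤ β * F.card) :
    ∃ v ∉ U, (F.filter fun ω => c a ω = v).Nonempty ∧
      ((blocked c (a + 1) b U (F.filter fun ω => c a ω = v)).card : ℝ) ≤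
        β * (F.filter fun ω => c a ω = v).card := by
  set I := F.image (c a)
  have hI : I.Nonempty := hF.image _
  have hsum : ∑ v ∈ I, (((blocked c a b U F).filter fun ω => c a ω = v).card : ℝ) ≤
      ∑ v ∈ I, β * ((F.filter fun ω => c a ω = v).card : ℝ) := by
    rw [← Finset.mul_sum]
    have e1 := Finset.card_eq_sum_card_fiberwise (f := c a) (s := F) (t := I)
      (fun x hx => Finset.mem_image_of_mem _ hx)
    have e2 := Finset.card_eq_sum_card_fiberwise (f := c a) (s := blocked c a b U F) (t := I)
      (fun x hx => Finset.mem_image_of_mem _ (Finset.mem_of_mem_filter x hx))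
    rw [e1, e2] at h
    push_cast at h
    exact h
  obtain ⟨v, hv, hle⟩ := Finset.exists_le_of_sum_le hI hsum
  have hne : (F.filter fun ω => c a ω = v).Nonempty := by
    obtain ⟨ω, hω, rfl⟩ := Finset.mem_image.mp hv
    exact ⟨ω, Finset.mem_filter.mpr ⟨hω, rfl⟩⟩
  have hpos : (0 : ℝ) < (F.filter fun ω => c a ω = v).card := by exact_mod_cast hne.card_pos
  refine ⟨v, fun hvU => ?_, hne, le_trans ?_ hle⟩
  · have : F.filter (fun ω => c a ω = v) ⊆ (blocked c a b U F).filter fun ω => c a ω = v := by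
      intro ω hω
      simp only [blocked, Finset.mem_filter] at hω ⊢
      exact ⟨⟨hω.1, a, le_rfl, hab, hω.2 ▸ hvU⟩, hω.2⟩
    have : ((F.filter fun ω => c a ω = v).card : ℝ) ≤
      ((blocked c a b U F).filter fun ω => c a ω = v).card := by
      exact_mod_cast Finset.card_le_card this
    nlinarith
  · have : blocked c (a + 1) b U (F.filter fun ω => c a ω = v) ⊆
        (blocked c a b U F).filter fun ω => c a ω = v := by
      intro ω hω
      simp only [blocked, Finset.mem_filter] at hω ⊢
      obtain ⟨⟨h1, h2⟩, i, h3, h4, h5⟩ := hω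
      exact ⟨⟨h1, i, by omega, h4, h5⟩, h2⟩
    exact_mod_cast Finset.card_le_card this

/-- One rooted copy can be found whenever few edges of `F` are blocked. -/
def SingleEmbedding (c : ℕ → Ω → V) (χ : V → ℕ) (q : ℝ) (ds : List ℕ) : Prop :=
  ∀ (a b : ℕ) (U : Finset V) (F : Finset Ω) (v : V) (β : ℝ), b = a + ds.length + 1 →
    F.Nonempty → (∀ ω ∈ F, ∀ i < b, χ (c i ω) = i) → (∀ ω ∈ F, c a ω = v) → v ∉ U →
    Spread c q ds (a + 1) F → ((blocked c (a + 1) b U F).card : ℝ) ≤ β * F.card →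
    β + q * ((ds.length : ℝ) * (ds.length + 1) / 2) < 1 →
    ∃ g : StarVertex ds ↪ V, GoodCopy c χ a b U F ds g

/-- Copies are added one by one. By `Spread`, a vertex at level j of an earlier copy blocks at most
a proportion q / (m · size of level j), so fewer than m copies with L + 1 levels each block at most
q(L + 1). -/
theorem exists_disjoint_copies {χ : V → ℕ} {q : ℝ} (hq : 0 ≤ q) {ds : List ℕ}
    (hds : ∀ d ∈ ds, 0 < d)
    (hS : SingleEmbedding c χ q ds) {m a b : ℕ} {U : Finset V} {F : Finset Ω} {β : ℝ}
    (hb : b = a + ds.length + 1) (hF : F.Nonempty) (hχ : ∀ ω ∈ F, ∀ i < b, χ (c i ω) = i)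
    (hsp : Spread c q (m :: ds) a F) (hbl : ((blocked c a b U F).card : ℝ) ≤ β * F.card)
    (hβ : β + q * (((ds.length : ℝ) + 1) * (ds.length + 2) / 2) < 1) :
    ∃ g : Fin m → (StarVertex ds ↪ V), (∀ i, GoodCopy c χ a b U F ds (g i)) ∧
      Pairwise fun i j => Disjoint (Set.range (g i)) (Set.range (g j)) := by
  suffices H : ∀ s ≤ m, ∃ g : Fin s → (StarVertex ds ↪ V),
      (∀ i, GoodCopy c χ a b U F ds (g i)) ∧
      Pairwise fun i j => Disjoint (Set.range (g i)) (Set.range (g j)) from H m le_rfl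
  intro s
  induction s with
  | zero => exact fun _ => ⟨fun i => i.elim0, fun i => i.elim0, fun i => i.elim0⟩
  | succ s ih =>
    intro hs
    obtain ⟨g, hg, hd⟩ := ih (by omega)
    set X : Finset V := Finset.univ.biUnion fun i : Fin s => Finset.univ.map (g i) with hX
    set L : ℝ := (ds.length : ℝ) with hL
    have hm : (0 : ℝ) < m := by exact_mod_cast (by omega : 0 < m)
    have hFpos : (0 : ℝ) < F.card := by exact_mod_cast hF.card_pos
    have hpt : ∀ i, ∀ y, ((F.filter fun ω => c (χ (g i y)) ω = g i y).card : ℝ) ≤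
        q * F.card / m * ((((ds.take (StarVertex.level ds y)).prod : ℕ) : ℝ))⁻¹ := by
      intro i y
      rw [(hg i).colour y]
      have h1 := hsp.1 _ (StarVertex.level_le ds y) (g i y)
      have hp : 0 < (ds.take (StarVertex.level ds y)).prod :=
        List.prod_pos fun d hd => hds d (List.mem_of_mem_take hd)
      have hp' : (0 : ℝ) < ((ds.take (StarVertex.level ds y)).prod : ℕ) := by exact_mod_cast hp
      rw [List.take_succ_cons, List.prod_cons, Nat.cast_mul] at h1
      rw [← div_eq_mul_inv, div_div, le_div_iff₀ (by positivity)]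
      exact h1
    have hX1 : ∑ x ∈ X, ((F.filter fun ω => c (χ x) ω = x).card : ℝ) ≤ q * (L + 1) * F.card := by
      calc _ ≤ ∑ i : Fin s, ∑ x ∈ Finset.univ.map (g i),
            ((F.filter fun ω => c (χ x) ω = x).card : ℝ) := by
            refine (Finset.sum_biUnion fun i _ j _ hij => ?_).le
            rw [Function.onFun, Finset.disjoint_left]
            intro x hx hx'
            obtain ⟨y, -, rfl⟩ := Finset.mem_map.mp hx
            obtain ⟨z, -, hz⟩ := Finset.mem_map.mp hx'
            exact Set.disjoint_left.mp (hd hij) ⟨y, rfl⟩ ⟨z, hz⟩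
        _ ≤ ∑ i : Fin s, q * F.card / m * (L + 1) := by
            refine Finset.sum_le_sum fun i _ => ?_
            rw [Finset.sum_map]
            refine (Finset.sum_le_sum fun y _ => hpt i y).trans ?_
            rw [← Finset.mul_sum]
            exact mul_le_mul_of_nonneg_left (StarVertex.sum_inv_take_prod_le ds) (by positivity)
        _ = (s / m : ℝ) * (q * (L + 1) * F.card) := by
            simp only [Finset.sum_const, Finset.card_univ, Fintype.card_fin, nsmul_eq_mul]
            field_simp
        _ ≤ _ := by
            refine mul_le_of_le_one_left (by positivity) ?_
            rw [div_le_one hm]; exact_mod_cast (by omega : s ≤ m)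
    have hbl' : ((blocked c a b (U ∪ X) F).card : ℝ) ≤ (β + q * (L + 1)) * F.card := by
      have := card_blocked_union_le hχ a U X
      linarith
    have hL0 : 0 ≤ L := by positivity
    have hqL : 0 ≤ q * L := by positivity
    have hqLL : 0 ≤ q * L * L := by positivity
    -- The budget (L+1)(L+2)/2 splits as (L+1) + L(L+1)/2: the first part pays for the earlier
    -- copies, the second is left for the recursion inside the fibre.
    obtain ⟨v, hvU, hne, hv⟩ := exists_fibre_blocked_le (by omega) hF (by nlinarith) hbl'
    obtain ⟨g', hg'⟩ := hS a b (U ∪ X) _ v _ hb hne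
      (fun ω hω => hχ ω (Finset.mem_of_mem_filter ω hω))
      (fun ω hω => (Finset.mem_filter.mp hω).2) hvU (hsp.2 v hne) hv (by nlinarith)
    have hnew : ∀ i, Disjoint (Set.range (g i)) (Set.range g') := by
      intro i
      rw [Set.disjoint_left]
      rintro _ ⟨y, rfl⟩ ⟨y', hy'⟩
      refine hg'.avoid y' (Finset.mem_union_right _ ?_)
      rw [hX, hy']
      simp only [Finset.mem_biUnion, Finset.mem_univ, true_and, Finset.mem_map]
      exact ⟨i, y, rfl⟩
    refine ⟨Fin.snoc (α := fun _ => StarVertex ds ↪ V) g g', fun i => ?_, fun i j hij => ?_⟩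
    · refine Fin.lastCases ?_ (fun i => ?_) i
      · rw [Fin.snoc_last]
        exact hg'.mono Finset.subset_union_left (Finset.filter_subset _ _)
      · rw [Fin.snoc_castSucc]; exact hg i
    · revert hij
      refine Fin.lastCases ?_ (fun i => ?_) i <;> refine Fin.lastCases ?_ (fun j => ?_) j <;>
        intro hij
      · exact absurd rfl hij
      · simpa only [Fin.snoc_last, Fin.snoc_castSucc] using (hnew j).symm
      · simpa only [Fin.snoc_last, Fin.snoc_castSucc] using hnew i
      · simpa only [Fin.snoc_castSucc] using hd fun h => hij (congrArg _ h)

/-- Mutual recursion with `exists_disjoint_copies`: below a fixed root the task is to find `d`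
disjoint smaller stars. Colours keep the root apart from the lower levels. -/
theorem singleEmbedding {χ : V → ℕ} {q : ℝ} (hq : 0 ≤ q) (ds : List ℕ) (hds : ∀ d ∈ ds, 0 < d) :
    SingleEmbedding c χ q ds := by
  induction ds with
  | nil =>
    rintro a b U F v β rfl ⟨ω, hω⟩ hχ hv hvU - - -
    refine ⟨⟨fun _ => v, fun _ _ _ => rfl⟩, fun _ => hvU, fun y => ?_, fun e he => ⟨ω, hω, ?_⟩⟩
    · change χ v = a + 0
      rw [← hv ω hω]
      exact hχ ω hω a (by simp)
    · rw [genStar, Finset.mem_singleton] at he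
      subst he
      rw [Finset.map_singleton, List.length_nil, Nat.add_zero, Nat.Ico_succ_singleton,
        Finset.image_singleton, hv ω hω]
      rfl
  | cons d ds ih =>
    intro a b U F v β hb hF hχ hv hvU hsp hbl hβ
    obtain ⟨hd, hds⟩ := List.forall_mem_cons.mp hds
    rw [List.length_cons] at hb hβ
    push_cast at hβ
    obtain ⟨g, hg, hdis⟩ := exists_disjoint_copies hq hds (ih hds) (b := b) (by omega) hF hχ hsp hbl
      (by convert hβ using 4; ring)
    obtain ⟨ω₀, hω₀⟩ := hF
    have hχv : χ v = a := by rw [← hv ω₀ hω₀]; exact hχ ω₀ hω₀ a (by omega)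
    let G : StarVertex (d :: ds) → V := fun o => Option.elim o v fun p => g p.1 p.2
    have hG : Function.Injective G := by
      have hne : ∀ i y, g i y ≠ v := by
        intro i y h
        have := (hg i).colour y
        rw [h, hχv] at this; omega
      rintro (_ | ⟨i, y⟩) (_ | ⟨j, z⟩) h
      · rfl
      · exact absurd h.symm (hne j z)
      · exact absurd h (hne i y)
      · have h' : g i y = g j z := h
        by_cases hij : i = j
        · subst hij; rw [(g i).injective h']
        · exact (Set.disjoint_left.mp (hdis hij) ⟨y, rfl⟩ ⟨z, h'.symm⟩).elim
    refine ⟨⟨G, hG⟩, ?_, ?_, ?_⟩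
    · rintro (_ | ⟨i, y⟩)
      · exact hvU
      · exact (hg i).avoid y
    · rintro (_ | ⟨i, y⟩)
      · exact hχv
      · refine ((hg i).colour y).trans ?_
        simp only [StarVertex.level]; omega
    · intro e he
      simp only [genStar, cone, copies, Finset.mem_map, Finset.mem_biUnion, Finset.mem_univ,
        true_and, Finset.mem_image] at he
      obtain ⟨_, ⟨i, e', he', rfl⟩, rfl⟩ := he
      obtain ⟨ω, hω, h⟩ := (hg i).edge e' he'
      refine ⟨ω, hω, ?_⟩
      rw [← Finset.insert_Ico_add_one_left_eq_Ico (show a < b by omega), Finset.image_insert, ← h,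
        hv ω hω]
      ext x
      simp only [Finset.mem_map, Finset.mem_insert, RelEmbedding.coe_toEmbedding,
        Finset.mem_insertNone, Function.Embedding.coeFn_mk]
      constructor
      · rintro ⟨_ | ⟨j, y⟩, ho, rfl⟩
        · exact Or.inl rfl
        · obtain ⟨z, hz, hz'⟩ := ho _ rfl
          simp only [Prod.mk.injEq] at hz'
          obtain ⟨rfl, rfl⟩ := hz'
          exact Or.inr ⟨z, hz, rfl⟩
      · rintro (rfl | ⟨y, hy, rfl⟩)
        · exact ⟨none, by simp, rfl⟩
        · refine ⟨some (i, y), ?_, rfl⟩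
          intro p hp
          simp only [Option.mem_def, Option.some.injEq] at hp
          exact ⟨y, hy, hp⟩

end Greedy

end RGraph

/-! ### Choosing an order of the four positions -/

/-- The inequalities on an ordered quadruple of positions that let the greedy embedding succeed. -/
structure NiceOrder (D : Finset (Fin 4) → ℝ) (l κ θ X : ℝ) (v u w x : Fin 4) : Prop where
  n1 : D {v} ≤ 3 * l + X
  n2 : D {u} ≤ 2 * l + X
  n3 : D {w} ≤ l + X
  n4 : D {x} ≤ θ + X
  n5 : D {v, u} - D {v} ≤ 2 * l + κ + X
  n6 : D {v, w} - D {v} ≤ l + κ + X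
  n7 : D {v, x} - D {v} ≤ l + X
  n8 : D {v, u, w} - D {v, u} ≤ 2 * l + κ + X
  n9 : D {v, u, x} - D {v, u} ≤ 2 * l + X

/-- Approximate supermodularity of a set function on `Fin 4`, with total at most `3 * l`. -/
structure NearSupermodular (D : Finset (Fin 4) → ℝ) (l η : ℝ) : Prop where
  sup : ∀ S T, D S + D T ≤ D (S ∪ T) + D (S ∩ T) + η
  empty : D ∅ = 0
  pos : ∀ S, -η ≤ D S
  tot : D Finset.univ ≤ 3 * l
  eta : 0 ≤ η

namespace NearSupermodular

variable {D : Finset (Fin 4) → ℝ} {l η : ℝ}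

/-- Four distinct positions. -/
def Four (v a b c : Fin 4) : Prop := v ≠ a ∧ v ≠ b ∧ v ≠ c ∧ a ≠ b ∧ a ≠ c ∧ b ≠ c

instance (v a b c : Fin 4) : Decidable (Four v a b c) := by unfold Four; infer_instance

theorem sup_of (h : NearSupermodular D l η) {S T U I : Finset (Fin 4)} (hU : S ∪ T = U)
    (hI : S ∩ T = I) : D S + D T ≤ D U + D I + η := by
  subst hU hI; exact h.sup S T

theorem sup_of_disjoint (h : NearSupermodular D l η) {S T U : Finset (Fin 4)} (hU : S ∪ T = U)
    (hI : S ∩ T = ∅) : D S + D T ≤ D U + η := by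
  have := h.sup_of hU hI
  rw [h.empty] at this; linarith

theorem pair (h : NearSupermodular D l η) {a b : Fin 4} (hab : a ≠ b) :
    D {a} + D {b} ≤ D {a, b} + η := by
  have e : ∀ a b : Fin 4, a ≠ b → ({a} ∪ {b} : Finset (Fin 4)) = {a, b} ∧
    ({a} ∩ {b} : Finset (Fin 4)) = ∅ := by decide
  exact h.sup_of_disjoint (e a b hab).1 (e a b hab).2

theorem triple (h : NearSupermodular D l η) {v a b c : Fin 4} (hf : Four v a b c) :
    D {v, a} + D {v, b} ≤ D {v, a, b} + D {v} + η := by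
  have e : ∀ v a b c : Fin 4, Four v a b c → ({v, a} ∪ {v, b} : Finset (Fin 4)) = {v, a, b} ∧
    ({v, a} ∩ {v, b} : Finset (Fin 4)) = {v} := by decide
  exact h.sup_of (e v a b c hf).1 (e v a b c hf).2

theorem triple_add_single (h : NearSupermodular D l η) {v a b c : Fin 4} (hf : Four v a b c) :
    D {v, a, b} + D {c} ≤ 3 * l + η := by
  have e : ∀ v a b c : Fin 4, Four v a b c → ({v, a, b} ∪ {c} : Finset (Fin 4)) = .univ ∧
    ({v, a, b} ∩ {c} : Finset (Fin 4)) = ∅ := by decide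
  have := h.sup_of_disjoint (e v a b c hf).1 (e v a b c hf).2
  linarith [h.tot]

theorem triple_triple (h : NearSupermodular D l η) {v a b c : Fin 4} (hf : Four v a b c) :
    D {v, a, b} + D {v, a, c} ≤ 3 * l + D {v, a} + η := by
  have e : ∀ v a b c : Fin 4, Four v a b c → ({v, a, b} ∪ {v, a, c} : Finset (Fin 4)) = .univ ∧
    ({v, a, b} ∩ {v, a, c} : Finset (Fin 4)) = {v, a} := by decide
  have := h.sup_of (e v a b c hf).1 (e v a b c hf).2
  linarith [h.tot]

theorem triple_pair (h : NearSupermodular D l η) {v a b c : Fin 4} (hf : Four v a b c) :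
    D {v, a, b} + D {v, c} ≤ 3 * l + D {v} + η := by
  have e : ∀ v a b c : Fin 4, Four v a b c → ({v, a, b} ∪ {v, c} : Finset (Fin 4)) = .univ ∧
    ({v, a, b} ∩ {v, c} : Finset (Fin 4)) = {v} := by decide
  have := h.sup_of (e v a b c hf).1 (e v a b c hf).2
  linarith [h.tot]

theorem pair_pair (h : NearSupermodular D l η) {v a b c : Fin 4} (hf : Four v a b c) :
    D {v, a} + D {b, c} ≤ 3 * l + η := by
  have e : ∀ v a b c : Fin 4, Four v a b c → ({v, a} ∪ {b, c} : Finset (Fin 4)) = .univ ∧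
    ({v, a} ∩ {b, c} : Finset (Fin 4)) = ∅ := by decide
  have := h.sup_of_disjoint (e v a b c hf).1 (e v a b c hf).2
  linarith [h.tot]

theorem triple_le (h : NearSupermodular D l η) {v a b c : Fin 4} (hf : Four v a b c) :
    D {v, a, b} ≤ 3 * l + 2 * η := by
  linarith [h.triple_add_single hf, h.pos {c}]

theorem le_pair (h : NearSupermodular D l η) {a b : Fin 4} (hab : a ≠ b) :
    D {a} - 2 * η ≤ D {a, b} := by
  linarith [h.pair hab, h.pos {b}]

/-- `l` is not assumed nonnegative; this bound lets a negative `l` be absorbed into the error `20 *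
η`. -/
theorem neg_le (h : NearSupermodular D l η) : -η ≤ 3 * l := by
  linarith [h.pos .univ, h.tot]

theorem pair_le_triple (h : NearSupermodular D l η) {v a b c : Fin 4} (hf : Four v a b c) :
    D {v, a} ≤ D {v, a, b} + 2 * η := by
  have e : ∀ v a b c : Fin 4, Four v a b c → ({v, a} ∪ {b} : Finset (Fin 4)) = {v, a, b} ∧
    ({v, a} ∩ {b} : Finset (Fin 4)) = ∅ := by decide
  have := h.sup_of_disjoint (e v a b c hf).1 (e v a b c hf).2
  linarith [h.pos {b}]

theorem single_le (h : NearSupermodular D l η) {v a b c : Fin 4} (hf : Four v a b c) :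
    D {v} ≤ 3 * l + 6 * η := by
  linarith [h.triple_le hf, h.le_pair hf.1, h.pair_le_triple hf]

theorem swap_last {v a b : Fin 4} : ({v, a, b} : Finset (Fin 4)) = {v, b, a} := by
  rw [Finset.pair_comm a b]

theorem swap_first {v a b : Fin 4} : ({v, a, b} : Finset (Fin 4)) = {a, v, b} :=
  Finset.insert_comm v a {b}

variable {κ θ : ℝ} {v a b c : Fin 4}

/-- Up to η, the increments D{v,i} - D{v} add up to at most 3l - D{v} ≤ 2l and dominate the D{i}.
Sorted decreasingly, they are at most 2l, l and 2l/3 ≤ θ. -/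
theorem nice_of_large (h : NearSupermodular D l η) (hθ : 3 * l ≤ 4 * θ) (hκ : 0 ≤ κ)
    (hf : Four v a b c) (hv : l ≤ D {v}) (hab : D {v, b} ≤ D {v, a}) (hbc : D {v, c} ≤ D {v, b}) :
    NiceOrder D l κ θ (20 * η) v a b c := by
  obtain ⟨h1, h2, h3, h4, h5, h6⟩ := id hf
  have := h.eta
  have := h.neg_le
  have := h.triple hf
  have := h.triple_pair hf
  have := h.pair h1
  have := h.pair h2
  have := h.pair h3
  have := h.le_pair h1
  have := h.le_pair h2
  have := h.le_pair h3
  have := h.triple_le hf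
  have := h.triple_le (show Four v a c b from ⟨h1, h3, h2, h5, h4, h6.symm⟩)
  have := h.single_le hf
  constructor <;> linarith

/-- Call v → i an arc if D{v,i} exceeds D{v} by more than l + 5η. Without arcs the single and pair
conditions are immediate, except that the last position needs D ≤ θ. The triples remain. -/
theorem nice_of_no_arc (h : NearSupermodular D l η) (hθ : 3 * l ≤ 4 * θ) (hκ : 0 ≤ κ)
    (hf : Four v a b c) (hv : D {v} ≤ l) (ha : D {a} ≤ D {v}) (hb : D {b} ≤ D {v})
    (hc : D {c} ≤ D {v}) (ha' : D {v, a} ≤ D {v} + l + 5 * η) (hb' : D {v, b} ≤ D {v} + l + 5 * η)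
    (hc' : D {v, c} ≤ D {v} + l + 5 * η) (hcb : D {c} ≤ D {b})
    (hm1 : D {v, a, b} ≤ D {v, b, c}) (hm2 : D {v, a, c} ≤ D {v, b, c}) :
    NiceOrder D l κ θ (20 * η) v a b c ∨ NiceOrder D l κ θ (20 * η) v b c a := by
  obtain ⟨h1, h2, h3, h4, h5, h6⟩ := id hf
  have := h.eta
  have := h.neg_le
  have := h.pos {v}
  have := h.pos {a}
  have := h.pos {b}
  have := h.pos {c}
  have f1 : Four v b c a := ⟨h2, h3, h1, h6, h4.symm, h5.symm⟩
  have f2 : Four v b a c := ⟨h2, h1, h3, h4.symm, h6, h5⟩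
  have f3 : Four v c a b := ⟨h3, h1, h2, h5.symm, h6.symm, h4⟩
  by_cases hcθ : D {c} ≤ θ
  · left
    -- As {v,b,c} is the largest triple through v, up to η this gives 2D{v,a,b} ≤ 3l + D{v,b} ≤ 4l +
    -- D{v}, whence D{v,a,b} - D{v,a} ≤ 2l; likewise for {v,a,c}.
    have t1 := h.triple_triple f2
    have t2 := h.triple_triple f3
    rw [swap_last (v := v) (a := b) (b := a)] at t1
    rw [swap_last (v := v) (a := c) (b := a), swap_last (v := v) (a := c) (b := b)] at t2
    have := h.le_pair h1
    constructor <;> linarith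
  · right
    push Not at hcθ
    -- Here D{v}, D{b}, D{c} all exceed θ, so D{v,b,c} is at least 3θ up to η and D{a} ≤ 3l - 3θ ≤
    -- θ. This uses 3l ≤ 4θ in full.
    have := h.triple_add_single f1
    have := h.triple f1
    have := h.pair h2
    have := h.pair h3
    have := h.triple_le f1
    have := h.triple_le f2
    constructor <;> linarith

/-- The arc v → a makes D{b,c} at most 2l - D{v}, hence D{c} ≤ 2l/3 ≤ θ, up to η. Only the increment
of {v,a} may be too large for the order v, a, b, c. If it exceeds 2l + κ, then D{a} ≤ D{v} ≤ l - κ ≤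
θ and all classes meeting b, c and one more position are small, so starting from b, c works. -/
theorem nice_of_one_arc (h : NearSupermodular D l η) (hθ : 3 * l ≤ 4 * θ) (hκ : 0 ≤ κ)
    (hθκ : l ≤ θ + κ)
    (hf : Four v a b c) (hv : D {v} ≤ l) (ha : D {a} ≤ D {v}) (hb : D {b} ≤ D {v})
    (hc : D {c} ≤ D {v}) (ha' : D {v} + l + 5 * η ≤ D {v, a})
    (hb' : D {v, b} ≤ D {v} + l + 5 * η)
    (hc' : D {v, c} ≤ D {v} + l + 5 * η) (hcb : D {c} ≤ D {b}) :
    NiceOrder D l κ θ (20 * η) v a b c ∨ NiceOrder D l κ θ (20 * η) b c v a := by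
  obtain ⟨h1, h2, h3, h4, h5, h6⟩ := id hf
  have := h.eta
  have := h.neg_le
  have := h.pos {v}
  have := h.pos {a}
  have := h.pos {b}
  have := h.pos {c}
  have := h.pair_pair hf
  have := h.pair h6
  by_cases hbig : D {v, a} - D {v} ≤ 2 * l + κ
  · left
    have := h.triple_le hf
    have := h.triple_le (show Four v a c b from ⟨h1, h3, h2, h5, h4, h6.symm⟩)
    constructor <;> linarith
  · right
    push Not at hbig
    have t1 := h.triple_pair (show Four v b c a from ⟨h2, h3, h1, h6, h4.symm, h5.symm⟩)
    have t2 := h.triple_pair (show Four a b c v from ⟨h4, h5, h1.symm, h6, h2.symm, h3.symm⟩)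
    have t3 := h.pair_le_triple (show Four b v c a from ⟨h2.symm, h6, h4.symm, h3, h1, h5.symm⟩)
    have t4 := h.pair_le_triple (show Four b a c v from ⟨h4.symm, h6, h2.symm, h5, h1.symm, h3.symm⟩)
    have t5 := h.pos {b, c}
    rw [swap_first (v := b)] at t3 t4
    rw [Finset.pair_comm a v] at t2
    have e1 : ({b, c, v} : Finset (Fin 4)) = {v, b, c} := by rw [swap_last, swap_first]
    have e2 : ({b, c, a} : Finset (Fin 4)) = {a, b, c} := by rw [swap_last, swap_first]
    constructor <;> (try rw [e1]) <;> (try rw [e2]) <;> linarith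

/-- Two arcs force D{v,a,b} ≥ D{v} + 2l, hence D{c} ≤ l - D{v} and D{v,c} ≤ l, up to η. If a or b
has D ≤ θ, it goes last and c first. Otherwise D{v} > θ makes D{c} ≤ l - θ ≤ θ, and c can go last.
-/
theorem nice_of_two_arcs (h : NearSupermodular D l η) (hθ : 3 * l ≤ 4 * θ) (hκ : 0 ≤ κ)
    (hθκ : l ≤ θ + κ)
    (hf : Four v a b c) (hv : D {v} ≤ l) (ha : D {a} ≤ D {v}) (hb : D {b} ≤ D {v})
    (hc : D {c} ≤ D {v}) (ha' : D {v} + l + 5 * η ≤ D {v, a})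
    (hb' : D {v} + l + 5 * η ≤ D {v, b}) (hba : D {v, b} ≤ D {v, a}) :
    NiceOrder D l κ θ (20 * η) v a b c ∨ NiceOrder D l κ θ (20 * η) c v a b ∨
      NiceOrder D l κ θ (20 * η) c v b a := by
  obtain ⟨h1, h2, h3, h4, h5, h6⟩ := id hf
  have := h.eta
  have := h.neg_le
  have := h.pos {v}
  have := h.pos {a}
  have := h.pos {b}
  have := h.pos {c}
  have := h.triple hf
  have := h.triple_add_single hf
  have t1 := h.triple_pair hf
  have t2 := h.triple_pair (show Four a v b c from ⟨h1.symm, h4, h5, h2, h3, h6⟩)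
  have t3 := h.triple_pair (show Four b v a c from ⟨h2.symm, h4.symm, h6, h1, h3, h5⟩)
  have e1 : ({b, v, a} : Finset (Fin 4)) = {v, a, b} := by rw [swap_first, swap_last]
  rw [swap_first] at t2
  rw [e1] at t3
  have t4 := h.triple_pair (show Four v c a b from ⟨h3, h1, h2, h5.symm, h6.symm, h4⟩)
  have t5 := h.triple_pair (show Four v c b a from ⟨h3, h2, h1, h6.symm, h5.symm, h4.symm⟩)
  rw [swap_first] at t4 t5
  have := h.pos {c, v}
  rw [Finset.pair_comm v c] at t1
  rw [Finset.pair_comm a c] at t2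
  rw [Finset.pair_comm b c] at t3
  by_cases h' : D {a} ≤ θ
  · right; right
    constructor <;> linarith
  by_cases h'' : D {b} ≤ θ
  · right; left
    constructor <;> linarith
  left
  push Not at h' h''
  have := h.triple_le hf
  have := h.triple_le (show Four v a c b from ⟨h1, h3, h2, h5, h4, h6.symm⟩)
  rw [Finset.pair_comm c v] at t1
  constructor <;> linarith

theorem exists_four_sorted (f : Fin 4 → ℝ) (v : Fin 4) :
    ∃ a b c, Four v a b c ∧ f b ≤ f a ∧ f c ≤ f b := by
  obtain ⟨a, b, c, h⟩ : ∃ a b c, Four v a b c := by revert v; decide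
  obtain ⟨h1, h2, h3, h4, h5, h6⟩ := id h
  rcases le_total (f a) (f b) with hab | hab <;> rcases le_total (f b) (f c) with hbc | hbc <;>
    rcases le_total (f a) (f c) with hac | hac
  · exact ⟨c, b, a, ⟨h3, h2, h1, h6.symm, h5.symm, h4.symm⟩, hbc, hab⟩
  · exact ⟨c, b, a, ⟨h3, h2, h1, h6.symm, h5.symm, h4.symm⟩, hbc, hab⟩
  · exact ⟨b, c, a, ⟨h2, h3, h1, h6, h4.symm, h5.symm⟩, hbc, hac⟩
  · exact ⟨b, a, c, ⟨h2, h1, h3, h4.symm, h6, h5⟩, hab, hac⟩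
  · exact ⟨c, a, b, ⟨h3, h1, h2, h5.symm, h6.symm, h4⟩, hac, hab⟩
  · exact ⟨a, c, b, ⟨h1, h3, h2, h5, h4, h6.symm⟩, hac, hbc⟩
  · exact ⟨a, b, c, h, hab, hbc⟩
  · exact ⟨a, b, c, h, hab, hbc⟩

theorem exists_niceOrder (h : NearSupermodular D l η) (hθ : 3 * l ≤ 4 * θ) (hκ : 0 ≤ κ)
    (hθκ : l ≤ θ + κ) :
    ∃ v a b c, Four v a b c ∧ NiceOrder D l κ θ (20 * η) v a b c := by
  obtain ⟨v, -, hv⟩ := Finset.exists_max_image .univ (fun i => D {i}) ⟨0, Finset.mem_univ _⟩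
  obtain ⟨a, b, c, hf, hab, hbc⟩ := exists_four_sorted (fun i => D {v, i}) v
  have hv' : ∀ i, D {i} ≤ D {v} := fun i => hv i (Finset.mem_univ i)
  have hη := h.eta
  rcases le_total l (D {v}) with hl | hl
  · exact ⟨v, a, b, c, hf, h.nice_of_large hθ hκ hf hl hab hbc⟩
  obtain ⟨h1, h2, h3, h4, h5, h6⟩ := id hf
  rcases le_total (D {v} + l + 5 * η) (D {v, b}) with hb | hb
  · rcases h.nice_of_two_arcs hθ hκ hθκ hf hl (hv' a) (hv' b) (hv' c) (hb.trans hab) hb hab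
      with h' | h' | h'
    · exact ⟨v, a, b, c, hf, h'⟩
    · exact ⟨c, v, a, b, ⟨h3.symm, h5.symm, h6.symm, h1, h2, h4⟩, h'⟩
    · exact ⟨c, v, b, a, ⟨h3.symm, h6.symm, h5.symm, h2, h1, h4.symm⟩, h'⟩
  rcases le_total (D {v} + l + 5 * η) (D {v, a}) with ha | ha
  · rcases le_total (D {c}) (D {b}) with hcb | hcb
    · rcases h.nice_of_one_arc hθ hκ hθκ hf hl (hv' a) (hv' b) (hv' c) ha hb (hbc.trans hb) hcb
        with h' | h'
      · exact ⟨v, a, b, c, hf, h'⟩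
      · exact ⟨b, c, v, a, ⟨h6, h2.symm, h4.symm, h3.symm, h5.symm, h1⟩, h'⟩
    · have hf' : Four v a c b := ⟨h1, h3, h2, h5, h4, h6.symm⟩
      rcases h.nice_of_one_arc hθ hκ hθκ hf' hl (hv' a) (hv' c) (hv' b) ha (hbc.trans hb) hb hcb
        with h' | h'
      · exact ⟨v, a, c, b, hf', h'⟩
      · exact ⟨c, b, v, a, ⟨h6.symm, h3.symm, h5.symm, h2.symm, h4.symm, h1⟩, h'⟩
  · have harc : ∀ i, i ≠ v → D {v, i} ≤ D {v} + l + 5 * η := by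
      intro i hi
      have : ∀ v a b c i : Fin 4, Four v a b c → i ≠ v → i = a ∨ i = b ∨ i = c := by decide
      rcases this v a b c i hf hi with rfl | rfl | rfl
      · exact ha
      · exact hb
      · exact hbc.trans hb
    -- Sorting by complements puts the position missing from the largest triple through v in the
    -- role of p.
    obtain ⟨p, q, r, hg, hpq, hqr⟩ := exists_four_sorted (fun i => D {i}ᶜ) v
    have e : ∀ v p q r : Fin 4, Four v p q r →
        ({p}ᶜ : Finset (Fin 4)) = {v, q, r} ∧ ({q}ᶜ : Finset (Fin 4)) = {v, p, r} ∧
        ({r}ᶜ : Finset (Fin 4)) = {v, p, q} := by decide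
    obtain ⟨e1, e2, e3⟩ := e v p q r hg
    simp only [e1, e2, e3] at hpq hqr
    obtain ⟨g1, g2, g3, g4, g5, g6⟩ := id hg
    rcases le_total (D {r}) (D {q}) with hrq | hrq
    · rcases h.nice_of_no_arc hθ hκ hg hl (hv' p) (hv' q) (hv' r) (harc p g1.symm)
        (harc q g2.symm) (harc r g3.symm) hrq (hqr.trans hpq) hpq with h' | h'
      · exact ⟨v, p, q, r, hg, h'⟩
      · exact ⟨v, q, r, p, ⟨g2, g3, g1, g6, g4.symm, g5.symm⟩, h'⟩
    · have hg' : Four v p r q := ⟨g1, g3, g2, g5, g4, g6.symm⟩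
      rw [swap_last (v := v) (a := q) (b := r)] at hpq
      rcases h.nice_of_no_arc hθ hκ hg' hl (hv' p) (hv' r) (hv' q) (harc p g1.symm)
        (harc r g3.symm) (harc q g2.symm) hrq hpq (hqr.trans hpq) with h' | h'
      · exact ⟨v, p, r, q, hg', h'⟩
      · exact ⟨v, r, q, p, ⟨g3, g2, g1, g6.symm, g5.symm, g4.symm⟩, h'⟩

end NearSupermodular

/-! ### Agreement classes and near-supermodularity -/

namespace RGraph

section Agree

open Classical

variable {V : Type*} {Ω E F : Finset (Fin 4 → V)} {S T : Finset (Fin 4)} {ω ω' : Fin 4 → V}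

/-- The members of `E` that agree with `ω` on the positions in `S`. -/
noncomputable def agree (E : Finset (Fin 4 → V)) (S : Finset (Fin 4)) (ω : Fin 4 → V) :
    Finset (Fin 4 → V) :=
  E.filter fun ω' => ∀ i ∈ S, ω' i = ω i

theorem mem_agree : ω' ∈ agree E S ω ↔ ω' ∈ E ∧ ∀ i ∈ S, ω' i = ω i := Finset.mem_filter

theorem self_mem_agree (h : ω ∈ E) : ω ∈ agree E S ω := mem_agree.mpr ⟨h, fun _ _ => rfl⟩

theorem agree_congr (h : ∀ i ∈ S, ω' i = ω i) : agree E S ω' = agree E S ω := by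
  ext x
  rw [mem_agree, mem_agree]
  exact and_congr_right fun _ => forall₂_congr fun i hi => by rw [h i hi]

theorem agree_empty : agree E ∅ ω = E := by
  ext x; simp [mem_agree]

theorem agree_mono (h : E ⊆ F) : agree E S ω ⊆ agree F S ω :=
  Finset.filter_subset_filter _ h

theorem card_agree_pos (h : ω ∈ E) : (0 : ℝ) < (agree E S ω).card := by
  exact_mod_cast Finset.card_pos.mpr ⟨ω, self_mem_agree h⟩

theorem agree_univ (h : ω ∈ E) : agree E .univ ω = {ω} := by
  ext x
  simp only [mem_agree, Finset.mem_univ, true_implies, Finset.mem_singleton]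
  refine ⟨fun h => funext h.2, ?_⟩
  rintro rfl
  exact ⟨h, fun _ => rfl⟩

/-- The reciprocals of the class sizes sum to at most one over part of a class. -/
theorem sum_inv_card_agree_le_one (hFE : F ⊆ E)
    (hF : ∀ ω ∈ F, ∀ ω' ∈ F, ∀ i ∈ S, ω i = ω' i) :
    ∑ ω ∈ F, ((agree E S ω).card : ℝ)⁻¹ ≤ 1 := by
  rcases F.eq_empty_or_nonempty with rfl | ⟨x, hx⟩
  · simp
  have h1 : ∀ ω ∈ F, ((agree E S ω).card : ℝ)⁻¹ = ((agree E S x).card : ℝ)⁻¹ := fun ω hω => by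
    rw [agree_congr (hF ω hω x hx)]
  rw [Finset.sum_congr rfl h1, Finset.sum_const, nsmul_eq_mul]
  have h2 : (F.card : ℝ) ≤ (agree E S x).card := by
    exact_mod_cast Finset.card_le_card fun ω hω => mem_agree.mpr ⟨hFE hω, hF ω hω x hx⟩
  exact mul_inv_le_one_of_le₀ h2 (by positivity)

/-- Expand the product of class sizes as a count of pairs (x, y), where x agrees with ω on S and y
on T. Such x and y agree on S ∩ T, and together they determine ω on S ∪ T; so for fixed (x, y) the
reciprocals of the S ∪ T classes sum to at most 1. Summing the remaining reciprocal over y gives 1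
for each x. -/
theorem sum_agree_mul_agree_div_le (Ω : Finset (Fin 4 → V)) (S T : Finset (Fin 4)) :
    ∑ ω ∈ Ω, ((agree Ω S ω).card : ℝ) * (agree Ω T ω).card *
      (((agree Ω (S ∪ T) ω).card : ℝ)⁻¹ * ((agree Ω (S ∩ T) ω).card : ℝ)⁻¹) ≤ Ω.card := by
  calc _ = ∑ ω ∈ Ω, ∑ x ∈ Ω, ∑ y ∈ Ω, if x ∈ agree Ω S ω ∧ y ∈ agree Ω T ω then
        ((agree Ω (S ∪ T) ω).card : ℝ)⁻¹ * ((agree Ω (S ∩ T) ω).card : ℝ)⁻¹ else 0 := by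
        refine Finset.sum_congr rfl fun ω _ => ?_
        rw [← Finset.sum_product', ← Finset.sum_filter, Finset.sum_const, nsmul_eq_mul,
          ← Nat.cast_mul, ← Finset.card_product]
        congr 3
        ext ⟨x, y⟩
        simp only [Finset.mem_product, Finset.mem_filter, mem_agree]
        tauto
    _ = ∑ x ∈ Ω, ∑ y ∈ Ω, ∑ ω ∈ Ω, if x ∈ agree Ω S ω ∧ y ∈ agree Ω T ω then
        ((agree Ω (S ∪ T) ω).card : ℝ)⁻¹ * ((agree Ω (S ∩ T) ω).card : ℝ)⁻¹ else 0 := by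
        rw [Finset.sum_comm]
        exact Finset.sum_congr rfl fun x _ => Finset.sum_comm
    _ ≤ ∑ x ∈ Ω, ∑ y ∈ Ω, if y ∈ agree Ω (S ∩ T) x then
        ((agree Ω (S ∩ T) x).card : ℝ)⁻¹ else 0 := by
        refine Finset.sum_le_sum fun x hx => Finset.sum_le_sum fun y hy => ?_
        rw [← Finset.sum_filter]
        split_ifs with hxy
        · have : ∀ ω ∈ Ω.filter fun ω => x ∈ agree Ω S ω ∧ y ∈ agree Ω T ω,
              ((agree Ω (S ∪ T) ω).card : ℝ)⁻¹ * ((agree Ω (S ∩ T) ω).card : ℝ)⁻¹ =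
              ((agree Ω (S ∪ T) ω).card : ℝ)⁻¹ * ((agree Ω (S ∩ T) x).card : ℝ)⁻¹ := by
            intro ω hω
            rw [Finset.mem_filter, mem_agree] at hω
            rw [agree_congr fun i hi => hω.2.1.2 i (Finset.mem_of_mem_inter_left hi)]
          rw [Finset.sum_congr rfl this, ← Finset.sum_mul]
          refine mul_le_of_le_one_left (by positivity)
            (sum_inv_card_agree_le_one (Finset.filter_subset _ _) ?_)
          intro ω hω ω' hω' i hi
          rw [Finset.mem_filter, mem_agree, mem_agree] at hω hω'
          rcases Finset.mem_union.mp hi with hi | hi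
          · rw [← hω.2.1.2 i hi, hω'.2.1.2 i hi]
          · rw [← hω.2.2.2 i hi, hω'.2.2.2 i hi]
        · refine (Finset.sum_eq_zero fun ω hω => absurd ?_ hxy).le
          rw [Finset.mem_filter, mem_agree, mem_agree] at hω
          refine mem_agree.mpr ⟨hy, fun i hi => ?_⟩
          rw [hω.2.1.2 i (Finset.mem_of_mem_inter_left hi),
            hω.2.2.2 i (Finset.mem_of_mem_inter_right hi)]
    _ = ∑ x ∈ Ω, 1 := by
        refine Finset.sum_congr rfl fun x hx => ?_
        rw [← Finset.sum_filter, Finset.sum_const, nsmul_eq_mul]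
        have : Ω.filter (fun y => y ∈ agree Ω (S ∩ T) x) = agree Ω (S ∩ T) x := by
          ext y; simp only [Finset.mem_filter, mem_agree]; tauto
        rw [this]
        exact mul_inv_cancel₀ (card_agree_pos hx).ne'
    _ = _ := by simp

theorem card_not_supermodular_le (Ω : Finset (Fin 4 → V)) (S T : Finset (Fin 4)) {δ : ℝ}
    (hδ : 0 < δ) :
    ((Ω.filter fun ω => ((agree Ω (S ∪ T) ω).card : ℝ) * (agree Ω (S ∩ T) ω).card <
      δ * ((agree Ω S ω).card * (agree Ω T ω).card)).card : ℝ) ≤ δ * Ω.card := by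
  have h := sum_agree_mul_agree_div_le Ω S T
  have h2 := (Finset.sum_le_sum_of_subset_of_nonneg (Finset.filter_subset
    (fun ω => ((agree Ω (S ∪ T) ω).card : ℝ) * (agree Ω (S ∩ T) ω).card <
      δ * ((agree Ω S ω).card * (agree Ω T ω).card)) Ω) fun ω _ _ => by positivity).trans h
  have h3 := Finset.card_nsmul_le_sum (Ω.filter fun ω =>
      ((agree Ω (S ∪ T) ω).card : ℝ) * (agree Ω (S ∩ T) ω).card <
      δ * ((agree Ω S ω).card * (agree Ω T ω).card))
      (fun ω => ((agree Ω S ω).card : ℝ) * (agree Ω T ω).card *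
        (((agree Ω (S ∪ T) ω).card : ℝ)⁻¹ * ((agree Ω (S ∩ T) ω).card : ℝ)⁻¹)) δ⁻¹ (fun ω hω => by
    obtain ⟨hω, hlt⟩ := Finset.mem_filter.mp hω
    have h1 := card_agree_pos (S := S ∪ T) hω
    have h2 := card_agree_pos (S := S ∩ T) hω
    rw [← mul_inv, ← div_eq_mul_inv, le_div_iff₀ (by positivity), inv_mul_le_iff₀ hδ]
    exact hlt.le)
  have h4 := h3.trans h2
  rwa [nsmul_eq_mul, ← div_eq_mul_inv, div_le_iff₀ hδ, mul_comm] at h4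

/-- The reciprocals of class sizes sum to at most one per class, and there are at most n^|S|
classes. -/
theorem card_small_agree_le [Fintype V] (Ω : Finset (Fin 4 → V)) (S : Finset (Fin 4)) {δ : ℝ}
    (hδ : 0 < δ) :
    ((Ω.filter fun ω => ((agree Ω S ω).card : ℝ) * (Fintype.card V : ℝ) ^ S.card <
      δ * Ω.card).card : ℝ) ≤ δ * Ω.card := by
  rcases Ω.eq_empty_or_nonempty with rfl | ⟨ω₀, hω₀⟩
  · simp
  set B := Ω.filter fun ω => ((agree Ω S ω).card : ℝ) * (Fintype.card V : ℝ) ^ S.card <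
      δ * Ω.card with hB
  have hV : (0 : ℝ) < Fintype.card V := by exact_mod_cast Fintype.card_pos_iff.mpr ⟨ω₀ 0⟩
  have hΩ : (0 : ℝ) < Ω.card := by exact_mod_cast Finset.card_pos.mpr ⟨_, hω₀⟩
  have h1 : ∑ ω ∈ B, ((agree Ω S ω).card : ℝ)⁻¹ ≤ (Fintype.card V : ℝ) ^ S.card := by
    rw [← Finset.sum_fiberwise (s := B) (fun (ω : Fin 4 → V) (i : S) => ω i)]
    refine (Finset.sum_le_card_nsmul _ _ 1 fun p _ => ?_).trans ?_
    · refine sum_inv_card_agree_le_one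
        ((Finset.filter_subset _ _).trans (Finset.filter_subset _ _)) ?_
      intro ω hω ω' hω' i hi
      have := (Finset.mem_filter.mp hω).2.trans (Finset.mem_filter.mp hω').2.symm
      exact congrFun this ⟨i, hi⟩
    · simp
  have h2 := Finset.card_nsmul_le_sum B (fun ω => ((agree Ω S ω).card : ℝ)⁻¹)
    ((Fintype.card V : ℝ) ^ S.card / (δ * Ω.card)) (fun ω hω => by
      obtain ⟨hω, hlt⟩ := Finset.mem_filter.mp hω
      have := card_agree_pos (S := S) hω
      rw [div_le_iff₀ (by positivity), inv_mul_eq_div, le_div_iff₀ this, mul_comm]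
      exact hlt.le)
  have h3 := h2.trans h1
  rw [nsmul_eq_mul, ← mul_div_assoc, div_le_iff₀ (by positivity), mul_comm] at h3
  exact le_of_mul_le_mul_left h3 (by positivity)

/-- Few members of `E` lie in classes of which `E` contains only a small part. -/
theorem card_sparse_le (Ω E : Finset (Fin 4 → V)) (S : Finset (Fin 4)) {δ : ℝ} (hδ : 0 < δ) :
    ((E.filter fun ω => ((agree E S ω).card : ℝ) < δ * (agree Ω S ω).card).card : ℝ) ≤
      δ * Ω.card := by
  set B := E.filter fun ω => ((agree E S ω).card : ℝ) < δ * (agree Ω S ω).card with hB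
  -- Double counting: for each x in Ω, the members of B agreeing with x on S lie in one class of E,
  -- so they contribute at most 1.
  have h1 : ∑ ω ∈ B, ((agree Ω S ω).card : ℝ) * ((agree E S ω).card : ℝ)⁻¹ ≤ Ω.card := by
    calc _ = ∑ ω ∈ B, ∑ x ∈ Ω, if x ∈ agree Ω S ω then ((agree E S ω).card : ℝ)⁻¹ else 0 := by
          refine Finset.sum_congr rfl fun ω _ => ?_
          rw [← Finset.sum_filter, Finset.sum_const, nsmul_eq_mul]
          congr 3
          ext y; simp only [Finset.mem_filter, mem_agree]; tauto
      _ = ∑ x ∈ Ω, ∑ ω ∈ B, if x ∈ agree Ω S ω then ((agree E S ω).card : ℝ)⁻¹ else 0 :=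
          Finset.sum_comm
      _ ≤ ∑ x ∈ Ω, 1 := by
          refine Finset.sum_le_sum fun x _ => ?_
          rw [← Finset.sum_filter]
          refine sum_inv_card_agree_le_one
            ((Finset.filter_subset _ _).trans (Finset.filter_subset _ _)) ?_
          intro ω hω ω' hω' i hi
          rw [← (mem_agree.mp (Finset.mem_filter.mp hω).2).2 i hi,
            (mem_agree.mp (Finset.mem_filter.mp hω').2).2 i hi]
      _ = _ := by simp
  have h2 := Finset.card_nsmul_le_sum B
      (fun ω => ((agree Ω S ω).card : ℝ) * ((agree E S ω).card : ℝ)⁻¹) δ⁻¹ (fun ω hω => by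
    obtain ⟨hω, hlt⟩ := Finset.mem_filter.mp hω
    have := card_agree_pos (S := S) hω
    rw [← div_eq_mul_inv, le_div_iff₀ (by positivity), inv_mul_le_iff₀ hδ]
    exact hlt.le)
  have h4 := h2.trans h1
  rwa [nsmul_eq_mul, ← div_eq_mul_inv, div_le_iff₀ hδ, mul_comm] at h4

/-- The logarithm of the density of the class of `ω`, relative to a random set of tuples. -/
noncomputable def logDensity [Fintype V] (Ω : Finset (Fin 4 → V)) (ω : Fin 4 → V)
    (S : Finset (Fin 4)) : ℝ :=
  Real.log ((agree Ω S ω).card * (Fintype.card V : ℝ) ^ S.card / Ω.card)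

/-- There are 256 pairs (S, T) and 16 sets S; each bad event has proportion at most 1/1024, and
272/1024 < 1/2. -/
theorem half_le_card_nearSupermodular [Fintype V] (Ω : Finset (Fin 4 → V)) {l : ℝ}
    (hl : (Fintype.card V : ℝ) ^ 4 ≤ Real.exp (3 * l) * Ω.card) :
    (Ω.card : ℝ) / 2 ≤
      (Ω.filter fun ω => NearSupermodular (logDensity Ω ω) l (Real.log 1024)).card := by
  set δ : ℝ := 1 / 1024 with hδ
  set B1 : Finset (Fin 4) × Finset (Fin 4) → Finset (Fin 4 → V) := fun p =>
    Ω.filter fun ω => ((agree Ω (p.1 ∪ p.2) ω).card : ℝ) * (agree Ω (p.1 ∩ p.2) ω).card <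
      δ * ((agree Ω p.1 ω).card * (agree Ω p.2 ω).card) with hB1
  set B2 : Finset (Fin 4) → Finset (Fin 4 → V) := fun S =>
    Ω.filter fun ω => ((agree Ω S ω).card : ℝ) * (Fintype.card V : ℝ) ^ S.card <
      δ * Ω.card with hB2
  set G := Ω.filter fun ω => NearSupermodular (logDensity Ω ω) l (Real.log 1024) with hG
  have hcov : Ω ⊆ G ∪ (Finset.univ.biUnion B1 ∪ Finset.univ.biUnion B2) := by
    intro ω hω
    by_contra hcon
    simp only [Finset.mem_union, Finset.mem_biUnion, Finset.mem_univ, true_and, not_or,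
      not_exists] at hcon
    obtain ⟨h1, h2, h3⟩ := hcon
    refine h1 (Finset.mem_filter.mpr ⟨hω, ?_⟩)
    have hV : (0 : ℝ) < Fintype.card V := by exact_mod_cast Fintype.card_pos_iff.mpr ⟨ω 0⟩
    have hΩ : (0 : ℝ) < Ω.card := by exact_mod_cast Finset.card_pos.mpr ⟨_, hω⟩
    have hpos : ∀ S, (0 : ℝ) < (agree Ω S ω).card * (Fintype.card V : ℝ) ^ S.card / Ω.card :=
      fun S => by have := card_agree_pos (S := S) hω; positivity
    refine ⟨fun S T => ?_, ?_, fun S => ?_, ?_, Real.log_nonneg (by norm_num)⟩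
    · have h2' := h2 (S, T)
      simp only [hB1, Finset.mem_filter, hω, true_and, not_lt] at h2'
      unfold logDensity
      rw [← Real.log_mul (hpos _).ne' (hpos _).ne', ← Real.log_mul (hpos _).ne' (hpos _).ne',
        ← Real.log_mul (mul_pos (hpos _) (hpos _)).ne' (by norm_num)]
      refine Real.log_le_log (mul_pos (hpos _) (hpos _)) ?_
      have hc := Finset.card_union_add_card_inter S T
      rw [div_mul_div_comm, div_mul_div_comm, div_mul_eq_mul_div]
      refine div_le_div_of_nonneg_right ?_ (by positivity)
      have e1 : ((agree Ω S ω).card : ℝ) * (Fintype.card V : ℝ) ^ S.card *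
          ((agree Ω T ω).card * (Fintype.card V : ℝ) ^ T.card) =
          ((agree Ω S ω).card * (agree Ω T ω).card) *
            (Fintype.card V : ℝ) ^ ((S ∪ T).card + (S ∩ T).card) := by
        rw [hc, pow_add]; ring
      have e2 : ((agree Ω (S ∪ T) ω).card : ℝ) * (Fintype.card V : ℝ) ^ (S ∪ T).card *
          ((agree Ω (S ∩ T) ω).card * (Fintype.card V : ℝ) ^ (S ∩ T).card) * 1024 =
          (((agree Ω (S ∪ T) ω).card : ℝ) * (agree Ω (S ∩ T) ω).card * 1024) *
            (Fintype.card V : ℝ) ^ ((S ∪ T).card + (S ∩ T).card) := by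
        rw [pow_add]; ring
      rw [e1, e2]
      refine mul_le_mul_of_nonneg_right ?_ (by positivity)
      rw [hδ] at h2'
      linarith
    · unfold logDensity
      rw [agree_empty, Finset.card_empty, pow_zero, mul_one, div_self hΩ.ne', Real.log_one]
    · have h3' := h3 S
      simp only [hB2, Finset.mem_filter, hω, true_and, not_lt] at h3'
      unfold logDensity
      rw [← Real.log_inv]
      refine Real.log_le_log (by norm_num) ?_
      rw [le_div_iff₀ hΩ]
      rw [hδ] at h3'
      linarith
    · unfold logDensity
      rw [agree_univ hω, Finset.card_singleton, Nat.cast_one, one_mul,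
        Real.log_le_iff_le_exp (by have := hpos .univ; positivity), div_le_iff₀ hΩ]
      simpa using hl
  have hc1 : ((Finset.univ.biUnion B1).card : ℝ) ≤ 256 * (δ * Ω.card) := by
    calc ((Finset.univ.biUnion B1).card : ℝ) ≤ ∑ p, ((B1 p).card : ℝ) := by
          exact_mod_cast Finset.card_biUnion_le
      _ ≤ ∑ _p : Finset (Fin 4) × Finset (Fin 4), δ * Ω.card :=
          Finset.sum_le_sum fun p _ => card_not_supermodular_le Ω p.1 p.2 (by norm_num)
      _ = _ := by
          simp only [Finset.sum_const, Finset.card_univ, Fintype.card_prod, Fintype.card_finset,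
            Fintype.card_fin]
          norm_num
  have hc2 : ((Finset.univ.biUnion B2).card : ℝ) ≤ 16 * (δ * Ω.card) := by
    calc ((Finset.univ.biUnion B2).card : ℝ) ≤ ∑ p, ((B2 p).card : ℝ) := by
          exact_mod_cast Finset.card_biUnion_le
      _ ≤ ∑ _p : Finset (Fin 4), δ * Ω.card :=
          Finset.sum_le_sum fun p _ => card_small_agree_le Ω p (by norm_num)
      _ = _ := by
          simp only [Finset.sum_const, Finset.card_univ, Fintype.card_finset, Fintype.card_fin]
          norm_num
  have h := (Finset.card_le_card hcov).trans (Finset.card_union_le _ _)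
  have h' := Finset.card_union_le (Finset.univ.biUnion B1) (Finset.univ.biUnion B2)
  have h'' : (Ω.card : ℝ) ≤ G.card + ((Finset.univ.biUnion B1).card +
    (Finset.univ.biUnion B2).card) := by exact_mod_cast h.trans (Nat.add_le_add_left h' _)
  rw [hδ] at hc1 hc2
  have : (0 : ℝ) ≤ Ω.card := by positivity
  linarith

end Agree

end RGraph

/-! ### Pruning, colouring and fixing the order of coordinates -/

namespace RGraph

section Agree

open Classical

variable {V : Type*} {Ω E F : Finset (Fin 4 → V)} {S T : Finset (Fin 4)} {ω ω' : Fin 4 → V}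

/-- The first `j` positions. -/
def firstPositions (j : ℕ) : Finset (Fin 4) := Finset.univ.filter fun i => i.val < j

theorem firstPositions_mono {i j : ℕ} (h : i ≤ j) : firstPositions i ⊆ firstPositions j := by
  intro x hx
  simp only [firstPositions, Finset.mem_filter, Finset.mem_univ, true_and] at hx ⊢
  omega

theorem firstPositions_zero : firstPositions 0 = ∅ := by decide

/-- Remove the members whose class on `S` has lost too many elements. -/
noncomputable def pruneAt (Ω : Finset (Fin 4 → V)) (δ : ℝ) (S : Finset (Fin 4))
    (E : Finset (Fin 4 → V)) : Finset (Fin 4 → V) :=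
  E.filter fun ω => δ * (agree Ω S ω).card ≤ (agree E S ω).card

/-- Pruning on S removes whole S-classes, so it leaves the surviving finer classes intact. -/
theorem agree_pruneAt {δ : ℝ} (hST : S ⊆ T) (hω : ω ∈ pruneAt Ω δ S E) :
    agree (pruneAt Ω δ S E) T ω = agree E T ω := by
  refine (agree_mono (Finset.filter_subset _ _)).antisymm fun x hx => ?_
  obtain ⟨hx, hxω⟩ := mem_agree.mp hx
  refine mem_agree.mpr ⟨Finset.mem_filter.mpr ⟨hx, ?_⟩, hxω⟩
  rw [agree_congr fun i hi => hxω i (hST hi), agree_congr fun i hi => hxω i (hST hi)]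
  exact (Finset.mem_filter.mp hω).2

theorem le_card_pruneAt {δ : ℝ} (hδ : 0 < δ) :
    (E.card : ℝ) ≤ (pruneAt Ω δ S E).card + δ * Ω.card := by
  have h := card_sparse_le Ω E S hδ
  have h2 := Finset.card_filter_add_card_filter_not (s := E)
    (fun ω => δ * (agree Ω S ω).card ≤ (agree E S ω).card)
  simp only [not_le] at h2
  rw [← h2]
  push_cast
  exact add_le_add le_rfl h

/-- Pruning goes from the finest prefix to the coarsest, so later rounds do not spoil earlier ones.
Three rounds lose at most 3δ|Ω|; the fourth δ|Ω| is the condition for j = 0. -/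
theorem exists_pruned {δ : ℝ} (hδ : 0 < δ) (hΩ : Ω.Nonempty) {E₀ : Finset (Fin 4 → V)}
    (h : 4 * δ * Ω.card ≤ E₀.card) :
    ∃ E ⊆ E₀, E.Nonempty ∧ ∀ ω ∈ E, ∀ j < 4,
      δ * (agree Ω (firstPositions j) ω).card ≤ (agree E (firstPositions j) ω).card := by
  set E₁ := pruneAt Ω δ (firstPositions 3) E₀ with hE₁
  set E₂ := pruneAt Ω δ (firstPositions 2) E₁ with hE₂
  set E₃ := pruneAt Ω δ (firstPositions 1) E₂ with hE₃
  have s1 : E₁ ⊆ E₀ := Finset.filter_subset _ _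
  have s2 : E₂ ⊆ E₁ := Finset.filter_subset _ _
  have s3 : E₃ ⊆ E₂ := Finset.filter_subset _ _
  have c1 : (E₀.card : ℝ) ≤ E₁.card + δ * Ω.card := le_card_pruneAt hδ
  have c2 : (E₁.card : ℝ) ≤ E₂.card + δ * Ω.card := le_card_pruneAt hδ
  have c3 : (E₂.card : ℝ) ≤ E₃.card + δ * Ω.card := le_card_pruneAt hδ
  have hpos : (0 : ℝ) < δ * Ω.card := mul_pos hδ (by exact_mod_cast hΩ.card_pos)
  have hc : δ * Ω.card ≤ E₃.card := by linarith
  refine ⟨E₃, s3.trans (s2.trans s1), ?_, fun ω hω j hj => ?_⟩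
  · rw [← Finset.card_pos]
    exact_mod_cast hpos.trans_le hc
  have m1 : firstPositions 1 ⊆ firstPositions 2 := firstPositions_mono (by norm_num)
  have m2 : firstPositions 2 ⊆ firstPositions 3 := firstPositions_mono (by norm_num)
  interval_cases j
  · rw [firstPositions_zero, agree_empty, agree_empty]; exact hc
  · rw [agree_pruneAt subset_rfl hω]
    exact (Finset.mem_filter.mp hω).2
  · rw [agree_pruneAt m1 hω, agree_pruneAt subset_rfl (s3 hω)]
    exact (Finset.mem_filter.mp (s3 hω)).2
  · rw [agree_pruneAt (m1.trans m2) hω, agree_pruneAt m2 (s3 hω),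
      agree_pruneAt subset_rfl (s2 (s3 hω))]
    exact (Finset.mem_filter.mp (s2 (s3 hω))).2

/-- The coordinates of a tuple, indexed by natural numbers. -/
def coordinate (V : Type*) (i : ℕ) (ω : Fin 4 → V) : V := ω (Fin.ofNat 4 i)

theorem coordinate_eq {i : ℕ} (hi : i < 4) : coordinate V i ω = ω ⟨i, hi⟩ := by
  unfold coordinate
  congr 1
  ext
  simp [Nat.mod_eq_of_lt hi]

theorem mem_firstPositions {j : ℕ} {i : Fin 4} : i ∈ firstPositions j ↔ i.val < j := by
  simp [firstPositions]

/-- The fibres visited by `Spread` are the classes of E on prefixes. Numerators are bounded above by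
classes of Ω, denominators below through pruning, at the cost of a factor 1/δ. -/
theorem spread_of_agree (hEΩ : E ⊆ Ω) {ms : List ℕ} (hms : ms.length = 4) {q δ : ℝ} (hδ : 0 < δ)
    (hq : 0 ≤ q)
    (h1 : ∀ ω ∈ E, ∀ j l : ℕ, j ≤ l → ∀ hl : l < 4,
      ((agree Ω (insert ⟨l, hl⟩ (firstPositions j)) ω).card : ℝ) *
        (((ms.drop j).take (l - j + 1)).prod : ℕ) ≤ q * (agree Ω (firstPositions j) ω).card)
    (h2 : ∀ ω ∈ E, ∀ j < 4,
      δ * (agree Ω (firstPositions j) ω).card ≤ (agree E (firstPositions j) ω).card)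
    (hE : E.Nonempty) :
    Spread (coordinate V) (q / δ) ms 0 E := by
  have key : ∀ (ms' : List ℕ) (off : ℕ), ms.drop off = ms' → ∀ ω₀ ∈ E,
      Spread (coordinate V) (q / δ) ms' off (agree E (firstPositions off) ω₀) := by
    intro ms'
    induction ms' with
    | nil => intro _ _ _ _; trivial
    | cons m ms' ih =>
      intro off hoff ω₀ hω₀
      have hlen : off + (ms'.length + 1) = 4 := by
        have := congrArg List.length hoff
        rw [List.length_drop, hms, List.length_cons] at this
        omega
      constructor
      · intro j hj v
        have hl : off + j < 4 := by omega
        rcases ((agree E (firstPositions off) ω₀).filter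
          fun ω => coordinate V (off + j) ω = v).eq_empty_or_nonempty with h | ⟨ω₁, hω₁⟩
        · rw [h]; simp only [Finset.card_empty, Nat.cast_zero, zero_mul]; positivity
        obtain ⟨hω₁, hv⟩ := Finset.mem_filter.mp hω₁
        obtain ⟨hω₁E, hω₁⟩ := mem_agree.mp hω₁
        have e1 : ((agree E (firstPositions off) ω₀).filter
            fun ω => coordinate V (off + j) ω = v) ⊆
            agree Ω (insert ⟨off + j, hl⟩ (firstPositions off)) ω₁ := by
          intro x hx
          obtain ⟨hx, hxv⟩ := Finset.mem_filter.mp hx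
          obtain ⟨hxE, hx⟩ := mem_agree.mp hx
          refine mem_agree.mpr ⟨hEΩ hxE, fun i hi => ?_⟩
          rcases Finset.mem_insert.mp hi with rfl | hi
          · rw [← coordinate_eq (ω := x) hl, ← coordinate_eq (ω := ω₁) hl, hxv, hv]
          · rw [hx i hi, hω₁ i hi]
        have e1' : (((agree E (firstPositions off) ω₀).filter
            fun ω => coordinate V (off + j) ω = v).card : ℝ) ≤
            (agree Ω (insert ⟨off + j, hl⟩ (firstPositions off)) ω₁).card := by
          exact_mod_cast Finset.card_le_card e1
        have e2 := h1 ω₁ hω₁E off (off + j) (by omega) hl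
        rw [hoff, Nat.add_sub_cancel_left] at e2
        have e3 := h2 ω₁ hω₁E off (by omega)
        rw [agree_congr (E := E) hω₁] at e3
        calc _ ≤ ((agree Ω (insert ⟨off + j, hl⟩ (firstPositions off)) ω₁).card : ℝ) *
              (((m :: ms').take (j + 1)).prod : ℕ) :=
              mul_le_mul_of_nonneg_right e1' (by positivity)
          _ ≤ q * (agree Ω (firstPositions off) ω₁).card := e2
          _ = q / δ * (δ * (agree Ω (firstPositions off) ω₁).card) := by field_simp
          _ ≤ _ := mul_le_mul_of_nonneg_left e3 (by positivity)
      · rintro u ⟨ω₁, hω₁⟩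
        obtain ⟨hω₁, hu⟩ := Finset.mem_filter.mp hω₁
        obtain ⟨hω₁E, hω₁⟩ := mem_agree.mp hω₁
        have e : (agree E (firstPositions off) ω₀).filter (fun ω => coordinate V off ω = u) =
            agree E (firstPositions (off + 1)) ω₁ := by
          have hl : off < 4 := by omega
          ext x
          rw [Finset.mem_filter, mem_agree, mem_agree, and_assoc]
          refine and_congr_right fun _ => ⟨?_, fun hx => ⟨fun i hi => ?_, ?_⟩⟩
          · rintro ⟨hx, hxu⟩ i hi
            rw [mem_firstPositions] at hi
            rcases Nat.lt_succ_iff_lt_or_eq.mp hi with hi | hi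
            · have hi := mem_firstPositions.mpr hi
              rw [hx i hi, hω₁ i hi]
            · have : i = ⟨off, hl⟩ := Fin.ext hi
              rw [this, ← coordinate_eq (ω := x) hl, ← coordinate_eq (ω := ω₁) hl, hxu, hu]
          · rw [hx i (firstPositions_mono (Nat.le_succ _) hi), hω₁ i hi]
          · rw [← hu, coordinate_eq hl, coordinate_eq hl]
            exact hx _ (mem_firstPositions.mpr (Nat.lt_succ_self _))
        rw [e]
        refine ih (off + 1) ?_ ω₁ hω₁E
        rw [← List.drop_drop, hoff, List.drop_one, List.tail_cons]
  obtain ⟨ω, hω⟩ := hE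
  have := key ms 0 rfl ω hω
  rwa [firstPositions_zero, agree_empty] at this

/-- A uniformly random colouring colours a given injective tuple correctly with probability 4^(-4) =
1/256. -/
theorem exists_colouring [Fintype V] (F : Finset (Fin 4 → V))
    (hF : ∀ ω ∈ F, Function.Injective ω) :
    ∃ χ : V → Fin 4, F.card ≤ 256 * (F.filter fun ω => ∀ i, χ (ω i) = i).card := by
  by_contra! hcon
  have h1 : ∀ ω ∈ F, Fintype.card (V → Fin 4) ≤
      256 * (Finset.univ.filter fun χ : V → Fin 4 => ∀ i, χ (ω i) = i).card := by
    intro ω hω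
    have hinj := hF ω hω
    -- Recolour the four entries of ω correctly and remember their old colours: this is injective,
    -- with 256 possible memories.
    have := Finset.card_le_card_of_injOn (s := (Finset.univ : Finset (V → Fin 4)))
      (t := (Finset.univ.filter fun χ : V → Fin 4 => ∀ i, χ (ω i) = i) ×ˢ
        (Finset.univ : Finset (Fin 4 → Fin 4)))
      (fun χ => (Function.extend ω id χ, χ ∘ ω))
      (fun χ _ => by simp [hinj.extend_apply]) (by
        intro χ _ χ' _ h
        obtain ⟨h1, h2⟩ := Prod.mk.inj h
        funext v
        by_cases hv : ∃ i, ω i = v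
        · obtain ⟨i, rfl⟩ := hv; exact congrFun h2 i
        · have := congrFun h1 v
          rwa [Function.extend_apply' _ _ _ hv, Function.extend_apply' _ _ _ hv] at this)
    rw [Finset.card_univ, Finset.card_product, Finset.card_univ] at this
    simp only [Fintype.card_fun, Fintype.card_fin] at this ⊢
    linarith
  have h2 := Finset.sum_lt_sum_of_nonempty (s := (Finset.univ : Finset (V → Fin 4)))
    ⟨fun _ => 0, Finset.mem_univ _⟩ fun χ _ => hcon χ
  rw [← Finset.mul_sum, Finset.sum_const, smul_eq_mul, Finset.card_univ] at h2
  have h3 : ∑ χ : V → Fin 4, (F.filter fun ω => ∀ i, χ (ω i) = i).card =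
      ∑ ω ∈ F, (Finset.univ.filter fun χ : V → Fin 4 => ∀ i, χ (ω i) = i).card := by
    simp only [Finset.card_filter]
    exact Finset.sum_comm
  have h4 := Finset.sum_le_sum h1
  rw [← Finset.mul_sum, ← h3, Finset.sum_const, smul_eq_mul] at h4
  rw [mul_comm F.card] at h4
  exact absurd h2 (not_lt.mpr h4)

theorem card_agree_comp (hsym : ∀ ω ∈ Ω, ∀ σ : Equiv.Perm (Fin 4), ω ∘ σ ∈ Ω)
    (σ : Equiv.Perm (Fin 4)) :
    (agree Ω S (ω ∘ σ)).card = (agree Ω (S.map σ.toEmbedding) ω).card := by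
  symm
  refine Finset.card_bij' (fun x _ => x ∘ σ) (fun x _ => x ∘ σ.symm) ?_ ?_ ?_ ?_
  · intro x hx
    obtain ⟨hx, h⟩ := mem_agree.mp hx
    exact mem_agree.mpr ⟨hsym x hx σ, fun i hi => h _ (Finset.mem_map_of_mem _ hi)⟩
  · intro x hx
    obtain ⟨hx, h⟩ := mem_agree.mp hx
    refine mem_agree.mpr ⟨hsym x hx σ.symm, fun i hi => ?_⟩
    obtain ⟨j, hj, rfl⟩ := Finset.mem_map.mp hi
    simpa using h j hj
  · intro x _; ext; simp
  · intro x _; ext; simp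

theorem logDensity_comp [Fintype V] (hsym : ∀ ω ∈ Ω, ∀ σ : Equiv.Perm (Fin 4), ω ∘ σ ∈ Ω)
    (σ : Equiv.Perm (Fin 4)) :
    logDensity Ω (ω ∘ σ) S = logDensity Ω ω (S.map σ.toEmbedding) := by
  unfold logDensity
  rw [card_agree_comp hsym, Finset.card_map]

/-- The members of `Ω` in the given order allow a greedy embedding. -/
noncomputable def niceSet [Fintype V] (Ω : Finset (Fin 4 → V)) (l κ θ X : ℝ) :
    Finset (Fin 4 → V) :=
  Ω.filter fun ω => NiceOrder (logDensity Ω ω) l κ θ X 0 1 2 3 ∧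
    logDensity Ω ω .univ - logDensity Ω ω {0, 1, 2} ≤ 3 * l + X

theorem exists_perm_mem_niceSet [Fintype V]
    (hsym : ∀ ω ∈ Ω, ∀ σ : Equiv.Perm (Fin 4), ω ∘ σ ∈ Ω) {l κ θ η : ℝ} (hω : ω ∈ Ω)
    (h : NearSupermodular (logDensity Ω ω) l η) (hθ : 3 * l ≤ 4 * θ) (hκ : 0 ≤ κ)
    (hθκ : l ≤ θ + κ) : ∃ σ : Equiv.Perm (Fin 4), ω ∘ σ ∈ niceSet Ω l κ θ (20 * η) := by
  obtain ⟨v, a, b, c, hf, hn⟩ := h.exists_niceOrder hθ hκ hθκ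
  have hbij : ∀ v a b c : Fin 4, NearSupermodular.Four v a b c →
      Function.Injective ![v, a, b, c] := by
    decide
  set σ : Equiv.Perm (Fin 4) := Equiv.ofBijective _
    (Finite.injective_iff_bijective.mp (hbij v a b c hf)) with hσ
  have s0 : σ 0 = v := rfl
  have s1 : σ 1 = a := rfl
  have s2 : σ 2 = b := rfl
  have s3 : σ 3 = c := rfl
  refine ⟨σ, Finset.mem_filter.mpr ⟨hsym ω hω σ, ?_, ?_⟩⟩
  swap
  · rw [logDensity_comp hsym, logDensity_comp hsym, Finset.map_univ_equiv]
    linarith [h.tot, h.pos (Finset.map σ.toEmbedding {0, 1, 2}), h.eta]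
  constructor <;>
    simp only [logDensity_comp hsym, Finset.map_insert, Finset.map_singleton,
      Equiv.coe_toEmbedding, s0, s1, s2, s3]
  · exact hn.n1
  · exact hn.n2
  · exact hn.n3
  · exact hn.n4
  · exact hn.n5
  · exact hn.n6
  · exact hn.n7
  · exact hn.n8
  · exact hn.n9

/-- Half of Ω is nearly supermodular, and each such tuple is a reordering of a nice one by one of 24
permutations; 2 · 24 = 48. -/
theorem card_le_card_niceSet [Fintype V]
    (hsym : ∀ ω ∈ Ω, ∀ σ : Equiv.Perm (Fin 4), ω ∘ σ ∈ Ω) {l κ θ : ℝ}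
    (hl : (Fintype.card V : ℝ) ^ 4 ≤ Real.exp (3 * l) * Ω.card) (hθ : 3 * l ≤ 4 * θ) (hκ : 0 ≤ κ)
    (hθκ : l ≤ θ + κ) :
    (Ω.card : ℝ) ≤ 48 * (niceSet Ω l κ θ (20 * Real.log 1024)).card := by
  have h1 := half_le_card_nearSupermodular Ω hl
  set G := Ω.filter fun ω => NearSupermodular (logDensity Ω ω) l (Real.log 1024)
  set N := niceSet Ω l κ θ (20 * Real.log 1024)
  have hcov : G ⊆ Finset.univ.biUnion fun σ : Equiv.Perm (Fin 4) => N.image fun ω => ω ∘ σ := by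
    intro ω hω
    obtain ⟨hω, h⟩ := Finset.mem_filter.mp hω
    obtain ⟨σ, hσ⟩ := exists_perm_mem_niceSet hsym hω h hθ hκ hθκ
    refine Finset.mem_biUnion.mpr ⟨σ.symm, Finset.mem_univ _, Finset.mem_image.mpr ⟨_, hσ, ?_⟩⟩
    ext; simp
  have h2 : G.card ≤ 24 * N.card := by
    refine (Finset.card_le_card hcov).trans (Finset.card_biUnion_le.trans ?_)
    refine (Finset.sum_le_card_nsmul _ _ N.card fun σ _ => Finset.card_image_le).trans ?_
    rw [Finset.card_univ, Fintype.card_perm, Fintype.card_fin, smul_eq_mul]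
    exact Nat.mul_le_mul_right _ (by decide)
  have h3 : (G.card : ℝ) ≤ 24 * N.card := by exact_mod_cast h2
  linarith

end Agree

end RGraph

/-! ### From the order lemma to degree conditions -/

namespace RGraph

section Agree

open Classical

variable {V : Type*} [Fintype V] {Ω : Finset (Fin 4 → V)} {S T : Finset (Fin 4)} {ω : Fin 4 → V}

theorem card_agree_mul_le (hω : ω ∈ Ω) {y : ℝ} (hST : T.card = S.card + 1)
    (h : logDensity Ω ω T - logDensity Ω ω S ≤ y) :
    ((agree Ω T ω).card : ℝ) * Fintype.card V ≤ Real.exp y * (agree Ω S ω).card := by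
  have hV : (0 : ℝ) < Fintype.card V := by exact_mod_cast Fintype.card_pos_iff.mpr ⟨ω 0⟩
  have hΩ : (0 : ℝ) < Ω.card := by exact_mod_cast Finset.card_pos.mpr ⟨_, hω⟩
  have hT := card_agree_pos (S := T) hω
  have hS := card_agree_pos (S := S) hω
  unfold logDensity at h
  rw [← Real.log_div (by positivity) (by positivity), Real.log_le_iff_le_exp (by positivity),
    div_div_div_cancel_right₀ hΩ.ne', hST, pow_succ, div_le_iff₀ (by positivity)] at h
  have hp : (0 : ℝ) < (Fintype.card V : ℝ) ^ S.card := by positivity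
  refine le_of_mul_le_mul_right ?_ hp
  linarith

/-- The orderings of the edges of a `4`-graph. -/
noncomputable def orderedEdges (G : RGraph 4 V) : Finset (Fin 4 → V) :=
  Finset.univ.filter fun ω => Function.Injective ω ∧ Finset.univ.image ω ∈ G.edges

theorem comp_mem_orderedEdges {G : RGraph 4 V} (hω : ω ∈ orderedEdges G)
    (σ : Equiv.Perm (Fin 4)) : ω ∘ σ ∈ orderedEdges G := by
  obtain ⟨-, h1, h2⟩ := Finset.mem_filter.mp hω
  refine Finset.mem_filter.mpr ⟨Finset.mem_univ _, h1.comp σ.injective, ?_⟩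
  rwa [← Finset.image_image, Finset.image_univ_equiv]

theorem card_edges_le_card_orderedEdges (G : RGraph 4 V) :
    G.edges.card ≤ (orderedEdges G).card := by
  refine (Finset.card_le_card fun e he => ?_).trans
    (Finset.card_image_le (f := fun ω : Fin 4 → V => Finset.univ.image ω))
  let f := e.equivFinOfCardEq (G.uniform e he)
  have hf : Finset.univ.image (fun i => (f.symm i : V)) = e := by
    ext x
    simp only [Finset.mem_image, Finset.mem_univ, true_and]
    constructor
    · rintro ⟨i, rfl⟩; exact (f.symm i).2
    · intro hx; exact ⟨f ⟨x, hx⟩, by simp⟩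
  refine Finset.mem_image.mpr ⟨fun i => (f.symm i : V), ?_, hf⟩
  refine Finset.mem_filter.mpr ⟨Finset.mem_univ _, ?_, by rw [hf]; exact he⟩
  exact Subtype.val_injective.comp f.symm.injective

/-- The proportion of orderings that survives colouring and pruning. -/
noncomputable def pruneRate : ℝ := 1 / 49152

/-- The loss in the order lemma, in multiplicative form. -/
noncomputable def orderLoss : ℝ := Real.exp (20 * Real.log 1024)

/-- The ratio between the scales of the order lemma and of the embedding. -/
noncomputable def scaleRatio : ℝ := 8 * orderLoss / (pruneRate / 20)

theorem one_le_orderLoss : 1 ≤ orderLoss :=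
  Real.one_le_exp (mul_nonneg (by norm_num) (Real.log_nonneg (by norm_num)))

theorem four_le_scaleRatio : 4 ≤ scaleRatio := by
  unfold scaleRatio pruneRate
  rw [le_div_iff₀ (by norm_num)]
  linarith [one_le_orderLoss]

theorem eight_mul_orderLoss : 8 * orderLoss = pruneRate / 20 * scaleRatio := by
  unfold scaleRatio pruneRate
  field_simp

/-- These are the ten conditions required by `spread_of_agree` for the parameters t, d, d, k: nine
come from `NiceOrder`, and the one for fixing the last position comes from the extra clause of
`niceSet`. -/
theorem card_agree_mul_prod_le_of_mem_niceSet {n k t d : ℕ} (hn : Fintype.card V = n) (ht : 0 < t)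
    (htk : t ≤ k) (hd : 0 < d) (hdk : d ^ 3 * k ≤ 8 * n)
    (hω : ω ∈ niceSet Ω (Real.log (d / scaleRatio ^ 2)) (Real.log k)
      (Real.log (d / (t * scaleRatio))) (20 * Real.log 1024)) (j l : ℕ)
    (hjl : j ≤ l) (hl : l < 4) :
    ((agree Ω (insert ⟨l, hl⟩ (firstPositions j)) ω).card : ℝ) *
      (((([t, d, d, k] : List ℕ).drop j).take (l - j + 1)).prod : ℕ) ≤
        pruneRate / 20 * (agree Ω (firstPositions j) ω).card := by
  obtain ⟨hωΩ, hnice, hlast⟩ := Finset.mem_filter.mp hω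
  clear hω
  set P := scaleRatio with hP
  have hP4 : 4 ≤ P := four_le_scaleRatio
  have hd' : (0 : ℝ) < d := by exact_mod_cast hd
  have hk' : (0 : ℝ) < k := by exact_mod_cast ht.trans_le htk
  have ht' : (0 : ℝ) < t := by exact_mod_cast ht
  have htk' : (t : ℝ) ≤ k := by exact_mod_cast htk
  have hq : (0 : ℝ) < pruneRate / 20 := by unfold pruneRate; norm_num
  have hn' : (0 : ℝ) < n := by
    rw [← hn]; exact_mod_cast Fintype.card_pos_iff.mpr ⟨ω 0⟩
  have hdk' : (d : ℝ) ^ 3 * k ≤ 8 * n := by exact_mod_cast hdk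
  set g : ℝ := d / P ^ 2 with hg
  have hg0 : 0 < g := by positivity
  have hgd : g * P ≤ d := by
    rw [hg, div_mul_eq_mul_div, div_le_iff₀ (by positivity)]
    nlinarith [mul_pos hd' (by linarith : (0 : ℝ) < P)]
  have hgd' : g ≤ d := by nlinarith
  -- Here m counts the star vertices to be placed at the level in question and z is the exponential
  -- of the bound from the order lemma. The factor 8 in `scaleRatio` pays for d^3 k ≤ 8n, which is
  -- the effect of rounding d up.
  have base : ∀ {m : ℕ} {z : ℝ} {S T T' : Finset (Fin 4)}, T' = T → T.card = S.card + 1 → 0 < z →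
      logDensity Ω ω T - logDensity Ω ω S ≤ Real.log z + 20 * Real.log 1024 →
      m * z * P ≤ d ^ 3 * k →
      ((agree Ω T' ω).card : ℝ) * m ≤ pruneRate / 20 * (agree Ω S ω).card := by
    intro m z S T T' hTT hST hz h hm
    subst hTT
    have h1 := card_agree_mul_le hωΩ hST h
    rw [hn, Real.exp_add, Real.exp_log hz] at h1
    have h2 : m * z * (8 * orderLoss) ≤ pruneRate / 20 * (8 * n) := by
      rw [eight_mul_orderLoss, ← hP]
      calc m * z * (pruneRate / 20 * P) = pruneRate / 20 * (m * z * P) := by ring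
        _ ≤ _ := mul_le_mul_of_nonneg_left (hm.trans hdk') hq.le
    refine le_of_mul_le_mul_right ?_ hn'
    have hS : (0 : ℝ) ≤ (agree Ω S ω).card := by positivity
    calc ((agree Ω T' ω).card : ℝ) * m * n = m * (((agree Ω T' ω).card : ℝ) * n) := by ring
      _ ≤ m * (z * orderLoss * (agree Ω S ω).card) :=
          mul_le_mul_of_nonneg_left h1 (by positivity)
      _ = m * z * orderLoss * (agree Ω S ω).card := by ring
      _ ≤ pruneRate / 20 * n * (agree Ω S ω).card := mul_le_mul_of_nonneg_right (by linarith) hS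
      _ = pruneRate / 20 * (agree Ω S ω).card * n := by ring
  have h0 : logDensity Ω ω ∅ = 0 := by
    unfold logDensity
    have : (0 : ℝ) < Ω.card := by exact_mod_cast Finset.card_pos.mpr ⟨_, hωΩ⟩
    rw [agree_empty, Finset.card_empty, pow_zero, mul_one, div_self this.ne', Real.log_one]
  have l3 : Real.log (g ^ 3) = 3 * Real.log g := by rw [Real.log_pow]; norm_num
  have l2 : Real.log (g ^ 2) = 2 * Real.log g := by rw [Real.log_pow]; norm_num
  have l2k : Real.log (g ^ 2 * k) = 2 * Real.log g + Real.log k := by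
    rw [Real.log_mul (by positivity) hk'.ne', l2]
  have l1k : Real.log (g * k) = Real.log g + Real.log k := Real.log_mul hg0.ne' hk'.ne'
  have hP0 : 0 < P := by linarith
  have hgg : (g : ℝ) ^ 2 * P ≤ d ^ 2 := by nlinarith
  have hggg : g ^ 3 * P ≤ (d : ℝ) ^ 3 := by
    calc g ^ 3 * P = g ^ 2 * P * g := by ring
      _ ≤ (d : ℝ) ^ 2 * d := mul_le_mul hgg hgd' hg0.le (by positivity)
      _ = (d : ℝ) ^ 3 := by ring
  have p0 : firstPositions 0 = ∅ := firstPositions_zero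
  have p1 : firstPositions 1 = {0} := by decide
  have p2 : firstPositions 2 = {0, 1} := by decide
  have p3 : firstPositions 3 = {0, 1, 2} := by decide
  have hj : j < 4 := by omega
  interval_cases j <;> interval_cases l <;>
    simp only [p0, p1, p2, p3, List.drop_zero, List.drop_succ_cons, List.take_succ_cons,
      List.take_zero, List.prod_cons, List.prod_nil, mul_one, tsub_zero, zero_add, le_refl,
      Nat.reduceAdd, Nat.reduceSub, Nat.reduceLeDiff] at hjl ⊢
  · refine base (z := g ^ 3) (show ({0} : Finset (Fin 4)) = {0} by decide) (by decide) (by positivity)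
      (by linarith [hnice.n1]) ?_
    calc _ = t * (g ^ 3 * P) := by ring
      _ ≤ k * (d : ℝ) ^ 3 := by gcongr
      _ = _ := by ring
  · refine base (z := g ^ 2) (show ({1} : Finset (Fin 4)) = {1} by decide) (by decide) (by positivity)
      (by linarith [hnice.n2]) ?_
    push_cast
    calc _ = t * (d * (g ^ 2 * P)) := by ring
      _ ≤ k * (d * (d : ℝ) ^ 2) := by gcongr
      _ = _ := by ring
  · refine base (z := g) (show ({2} : Finset (Fin 4)) = {2} by decide) (by decide) (by positivity)
      (by linarith [hnice.n3]) ?_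
    push_cast
    calc _ = t * (d * (d * (g * P))) := by ring
      _ ≤ k * (d * (d * (d : ℝ))) := by gcongr
      _ = _ := by ring
  · refine base (z := d / (t * P)) (show ({3} : Finset (Fin 4)) = {3} by decide) (by decide) (by positivity)
      (by linarith [hnice.n4]) ?_
    push_cast
    -- The definition of θ as log (d/(tP)) is what makes this case an equality.
    refine le_of_eq ?_
    field_simp
  · refine base (z := g ^ 2 * k) (show ({1, 0} : Finset (Fin 4)) = {0, 1} by decide) (by decide) (by positivity)
      (by linarith [hnice.n5]) ?_
    calc _ = d * (k * (g ^ 2 * P)) := by ring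
      _ ≤ d * (k * (d : ℝ) ^ 2) := by gcongr
      _ = _ := by ring
  · refine base (z := g * k) (show ({2, 0} : Finset (Fin 4)) = {0, 2} by decide) (by decide) (by positivity)
      (by linarith [hnice.n6]) ?_
    push_cast
    calc _ = d * (d * (k * (g * P))) := by ring
      _ ≤ d * (d * (k * (d : ℝ))) := by gcongr
      _ = _ := by ring
  · refine base (z := g) (show ({3, 0} : Finset (Fin 4)) = {0, 3} by decide) (by decide) (by positivity)
      (by linarith [hnice.n7]) ?_
    push_cast
    calc _ = d * (d * (k * (g * P))) := by ring
      _ ≤ d * (d * (k * (d : ℝ))) := by gcongr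
      _ = _ := by ring
  · refine base (z := g ^ 2 * k) (show ({2, 0, 1} : Finset (Fin 4)) = {0, 1, 2} by decide) (by decide) (by positivity)
      (by linarith [hnice.n8]) ?_
    calc _ = d * (k * (g ^ 2 * P)) := by ring
      _ ≤ d * (k * (d : ℝ) ^ 2) := by gcongr
      _ = _ := by ring
  · refine base (z := g ^ 2) (show ({3, 0, 1} : Finset (Fin 4)) = {0, 1, 3} by decide) (by decide) (by positivity)
      (by linarith [hnice.n9]) ?_
    push_cast
    calc _ = d * (k * (g ^ 2 * P)) := by ring
      _ ≤ d * (k * (d : ℝ) ^ 2) := by gcongr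
      _ = _ := by ring
  · refine base (z := g ^ 3) (show ({3, 0, 1, 2} : Finset (Fin 4)) = .univ by decide) (by decide) (by positivity)
      (by linarith [hlast]) ?_
    calc _ = k * (g ^ 3 * P) := by ring
      _ ≤ k * (d : ℝ) ^ 3 := by gcongr
      _ = _ := by ring

end Agree

end RGraph

/-! ### Proof of part (a) -/

namespace RGraph

open Classical in
theorem containsDisjoint_St4_of_nat {V : Type*} [Fintype V] (G : RGraph 4 V) {n k t d : ℕ}
    (hn : Fintype.card V = n) (ht : 0 < t) (htk : t ≤ k) (hd : 0 < d) (hdk : d ^ 3 * k ≤ 8 * n)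
    (hnd : n ≤ d ^ 3 * k) (htd : t ^ 4 ≤ 16 * d)
    (hG : scaleRatio ^ 6 * k * (n : ℝ) ^ 3 ≤ G.edges.card) :
    G.ContainsDisjoint t (St4 d d k) := by
  set P := scaleRatio with hP
  have hP4 : 4 ≤ P := four_le_scaleRatio
  have hk : 0 < k := ht.trans_le htk
  have hd' : (0 : ℝ) < d := by exact_mod_cast hd
  have hk' : (0 : ℝ) < k := by exact_mod_cast hk
  have hk1 : (1 : ℝ) ≤ k := by exact_mod_cast hk
  have ht' : (0 : ℝ) < t := by exact_mod_cast ht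
  have htk' : (t : ℝ) ≤ k := by exact_mod_cast htk
  have hnd' : (n : ℝ) ≤ (d : ℝ) ^ 3 * k := by exact_mod_cast hnd
  have htd' : (t : ℝ) ^ 4 ≤ 16 * d := by exact_mod_cast htd
  have hP0 : 0 < P := by linarith
  have hn0 : 0 < n := by
    have : 0 < d ^ 3 * k := by positivity
    omega
  have hn0' : (0 : ℝ) < n := by exact_mod_cast hn0
  set Ω := orderedEdges G with hΩ
  have hΩG : (G.edges.card : ℝ) ≤ Ω.card := by exact_mod_cast card_edges_le_card_orderedEdges G
  have hG' : P ^ 6 * k * (n : ℝ) ^ 3 ≤ Ω.card := hG.trans hΩG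
  have hΩpos : (0 : ℝ) < Ω.card := lt_of_lt_of_le (by positivity) hG'
  have hg : 0 < (d : ℝ) / P ^ 2 := by positivity
  have hθ0 : 0 < (d : ℝ) / (t * P) := by positivity
  -- With l = log (d/P^2), the bound 3l costs P^6; this fixes the constant C.
  have htot : (Fintype.card V : ℝ) ^ 4 ≤ Real.exp (3 * Real.log (d / P ^ 2)) * Ω.card := by
    have e : Real.exp (3 * Real.log (d / P ^ 2)) = (d / P ^ 2 : ℝ) ^ 3 := by
      rw [← Real.exp_log (pow_pos hg 3), Real.log_pow]; norm_num
    rw [e, hn]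
    calc (n : ℝ) ^ 4 = n * (n : ℝ) ^ 3 := by ring
      _ ≤ (d : ℝ) ^ 3 * k * (n : ℝ) ^ 3 := by gcongr
      _ = (d / P ^ 2 : ℝ) ^ 3 * (P ^ 6 * k * (n : ℝ) ^ 3) := by field_simp
      _ ≤ _ := by gcongr
  -- This amounts to t^4 ≤ d P^2, which follows from t^4 ≤ 16d and P ≥ 4.
  have hθ : 3 * Real.log (d / P ^ 2) ≤ 4 * Real.log (d / (t * P)) := by
    have e3 : Real.log ((d / P ^ 2 : ℝ) ^ 3) = 3 * Real.log (d / P ^ 2) := by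
      rw [Real.log_pow]; norm_num
    have e4 : Real.log ((d / (t * P) : ℝ) ^ 4) = 4 * Real.log (d / (t * P)) := by
      rw [Real.log_pow]; norm_num
    rw [← e3, ← e4]
    refine Real.log_le_log (by positivity) ?_
    rw [div_pow, div_pow, div_le_div_iff₀ (by positivity) (by positivity)]
    calc (d : ℝ) ^ 3 * (t * P) ^ 4 = (d : ℝ) ^ 3 * P ^ 4 * t ^ 4 := by ring
      _ ≤ (d : ℝ) ^ 3 * P ^ 4 * (16 * d) := by gcongr
      _ = (d : ℝ) ^ 4 * P ^ 4 * 4 ^ 2 := by ring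
      _ ≤ (d : ℝ) ^ 4 * P ^ 4 * P ^ 2 := by gcongr
      _ = _ := by ring
  have hθκ : Real.log (d / P ^ 2) ≤ Real.log (d / (t * P)) + Real.log k := by
    rw [← Real.log_mul hθ0.ne' hk'.ne']
    refine Real.log_le_log hg ?_
    rw [div_mul_eq_mul_div, div_le_div_iff₀ (by positivity) (by positivity)]
    calc (d : ℝ) * (t * P) ≤ d * (k * P) := by gcongr
      _ = d * k * P := by ring
      _ ≤ d * k * P ^ 2 := by gcongr; nlinarith
  have h48 := card_le_card_niceSet (fun ω hω σ => comp_mem_orderedEdges hω σ) htot hθ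
    (Real.log_nonneg hk1) hθκ
  set N := niceSet Ω (Real.log (d / P ^ 2)) (Real.log k) (Real.log (d / (t * P)))
    (20 * Real.log 1024) with hN
  have hNΩ : N ⊆ Ω := Finset.filter_subset _ _
  obtain ⟨χ, hχ⟩ := exists_colouring N fun ω hω => (Finset.mem_filter.mp (hNΩ hω)).2.1
  have hχ' : (N.card : ℝ) ≤ 256 * (N.filter fun ω => ∀ i, χ (ω i) = i).card := by
    exact_mod_cast hχ
  have hδ : 0 < pruneRate := by unfold pruneRate; norm_num
  -- The losses are 48 from reordering, 256 from colouring and 4 from pruning: 48 · 256 · 4 = 49152.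
  obtain ⟨E, hEN, hE, hE2⟩ := exists_pruned (Ω := Ω) hδ
    (Finset.card_pos.mp (by exact_mod_cast hΩpos))
    (E₀ := N.filter fun ω => ∀ i, χ (ω i) = i) (by unfold pruneRate; linarith)
  have hEN' : E ⊆ N := hEN.trans (Finset.filter_subset _ _)
  have hsp := spread_of_agree (Ω := Ω) (hEN'.trans hNΩ) (ms := [t, d, d, k]) rfl (q := pruneRate / 20)
    hδ (by positivity) (fun ω hω j l hjl hl =>
      card_agree_mul_prod_le_of_mem_niceSet hn ht htk hd hdk (hEN' hω) j l hjl hl) hE2 hE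
  have hq : pruneRate / 20 / pruneRate = 1 / 20 := by field_simp
  rw [hq] at hsp
  have hds : ∀ x ∈ [d, d, k], 0 < x := by simp [hd, hk]
  -- Nothing is blocked at the start, and q = 1/20 with L = 3 uses the budget 10/20 < 1.
  obtain ⟨g, hg1, hg2⟩ := exists_disjoint_copies (χ := fun v => (χ v).val) (ds := [d, d, k])
    (m := t) (a := 0) (b := 4) (U := ∅) (F := E) (β := 0) (by norm_num) hds
    (singleEmbedding (by norm_num) _ hds) rfl hE (by
      intro ω hω i hi
      rw [coordinate_eq hi, (Finset.mem_filter.mp (hEN hω)).2]) hsp (by simp [blocked])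
    (by norm_num)
  refine ⟨g, fun i e he => ?_, hg2⟩
  obtain ⟨ω, hω, h⟩ := (hg1 i).edge e he
  have hωG := (Finset.mem_filter.mp (hNΩ (hEN' hω))).2.2
  rw [h]
  convert hωG using 1
  ext x
  simp only [Finset.mem_image, Finset.mem_Ico, Finset.mem_univ, true_and, Nat.zero_le]
  constructor
  · rintro ⟨i, hi, rfl⟩; exact ⟨⟨i, hi⟩, (coordinate_eq hi).symm⟩
  · rintro ⟨i, rfl⟩; exact ⟨i.val, i.2, coordinate_eq i.2⟩

theorem card_edges_le_choose {V : Type*} [Fintype V] {r : ℕ} (G : RGraph r V) :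
    G.edges.card ≤ (Fintype.card V).choose r := by
  have : G.edges ⊆ Finset.powersetCard r Finset.univ := fun e he =>
    Finset.mem_powersetCard.mpr ⟨Finset.subset_univ _, G.uniform e he⟩
  simpa [Finset.card_powersetCard] using Finset.card_le_card this

/-- The rounded parameters of the generalised stars. -/
theorem ceil_parameters {n k : ℕ} {d : ℝ} (hn : 0 < n) (hk : 0 < k) (hkn : k ≤ n)
    (hd : d = ((n : ℝ) / k) ^ (1 / 3 : ℝ)) :
    0 < ⌈d⌉₊ ∧ ⌈d⌉₊ ^ 3 * k ≤ 8 * n ∧ n ≤ ⌈d⌉₊ ^ 3 * k ∧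
    0 < ⌈min (k : ℝ) (d ^ (1 / 4 : ℝ))⌉₊ ∧ ⌈min (k : ℝ) (d ^ (1 / 4 : ℝ))⌉₊ ≤ k ∧
    ⌈min (k : ℝ) (d ^ (1 / 4 : ℝ))⌉₊ ^ 4 ≤ 16 * ⌈d⌉₊ ∧
    (k ≤ ⌈min (k : ℝ) (d ^ (1 / 4 : ℝ))⌉₊ ∨
      n ^ 3 * k ≤ (⌈min (k : ℝ) (d ^ (1 / 4 : ℝ))⌉₊ * ⌈d⌉₊ ^ 2 * k) ^ 4) := by
  have hn' : (0 : ℝ) < n := by exact_mod_cast hn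
  have hk' : (0 : ℝ) < k := by exact_mod_cast hk
  have hk1 : (1 : ℝ) ≤ k := by exact_mod_cast hk
  have h1 : 1 ≤ (n : ℝ) / k := by rw [le_div_iff₀ hk']; exact_mod_cast (by omega : 1 * k ≤ n)
  have hd1 : 1 ≤ d := hd ▸ Real.one_le_rpow h1 (by norm_num)
  have hd3 : d ^ 3 * k = n := by
    rw [hd, ← Real.rpow_natCast, ← Real.rpow_mul (by positivity)]
    norm_num
    field_simp
  set s := d ^ (1 / 4 : ℝ) with hs
  have hs1 : 1 ≤ s := Real.one_le_rpow hd1 (by norm_num)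
  have hs4 : s ^ 4 = d := by
    rw [hs, ← Real.rpow_natCast, ← Real.rpow_mul (by positivity)]
    norm_num
  have hD1 : d ≤ (⌈d⌉₊ : ℝ) := Nat.le_ceil d
  have hD2 : (⌈d⌉₊ : ℝ) ≤ 2 * d := by
    have := Nat.ceil_lt_add_one (by linarith : 0 ≤ d); linarith
  have hm1 : 1 ≤ min (k : ℝ) s := le_min hk1 hs1
  set T := ⌈min (k : ℝ) s⌉₊ with hT
  have hT1 : min (k : ℝ) s ≤ T := Nat.le_ceil _
  have hT2 : (T : ℝ) ≤ 2 * s := by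
    have := Nat.ceil_lt_add_one (by linarith : 0 ≤ min (k : ℝ) s)
    have := min_le_right (k : ℝ) s
    linarith
  refine ⟨Nat.ceil_pos.mpr (by linarith), ?_, ?_, Nat.ceil_pos.mpr (by linarith),
    Nat.ceil_le.mpr (min_le_left _ _), ?_, ?_⟩
  · have : (⌈d⌉₊ : ℝ) ^ 3 * k ≤ 8 * n := by
      calc (⌈d⌉₊ : ℝ) ^ 3 * k ≤ (2 * d) ^ 3 * k := by gcongr
        _ = 8 * (d ^ 3 * k) := by ring
        _ = _ := by rw [hd3]
    exact_mod_cast this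
  · have : (n : ℝ) ≤ (⌈d⌉₊ : ℝ) ^ 3 * k := by rw [← hd3]; gcongr
    exact_mod_cast this
  · have : (T : ℝ) ^ 4 ≤ 16 * ⌈d⌉₊ := by
      calc (T : ℝ) ^ 4 ≤ (2 * s) ^ 4 := by gcongr
        _ = 16 * d := by rw [mul_pow, hs4]; norm_num
        _ ≤ _ := by gcongr
    exact_mod_cast this
  -- Either t = k, or t is at least d^(1/4) and then (t d^2 k)^4 ≥ d^9 k^4 = n^3 k for the unrounded
  -- d. The two cases need different host graphs in part (b).
  · rcases le_total (k : ℝ) s with h | h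
    · left
      rw [min_eq_left h] at hT1
      exact_mod_cast hT1
    · right
      rw [min_eq_right h] at hT1
      have : (n : ℝ) ^ 3 * k ≤ ((T : ℝ) * (⌈d⌉₊ : ℝ) ^ 2 * k) ^ 4 := by
        calc (n : ℝ) ^ 3 * k = (s * d ^ 2 * k) ^ 4 := by
              have : (s * d ^ 2 * k) ^ 4 = s ^ 4 * (d ^ 8 * k ^ 4) := by ring
              rw [this, hs4, ← hd3]; ring
          _ ≤ _ := by gcongr
      exact_mod_cast this

theorem containsDisjoint_St4 {n k : ℕ} {d : ℝ} (hn : 0 < n) (hk : 0 < k)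
    (hd : d = ((n : ℝ) / k) ^ (1 / 3 : ℝ)) (G : RGraph 4 (Fin n))
    (hG : scaleRatio ^ 6 * k * (n : ℝ) ^ 3 ≤ G.edges.card) :
    G.ContainsDisjoint ⌈min (k : ℝ) (d ^ (1 / 4 : ℝ))⌉₊ (St4 ⌈d⌉₊ ⌈d⌉₊ k) := by
  have hkn : k ≤ n := by
    have hn' : (0 : ℝ) < n := by exact_mod_cast hn
    have h1 : G.edges.card ≤ n ^ 4 := by
      simpa using (card_edges_le_choose G).trans (Nat.choose_le_pow _ _)
    have h2 : (G.edges.card : ℝ) ≤ (n : ℝ) ^ 4 := by exact_mod_cast h1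
    have h3 : 1 ≤ scaleRatio ^ 6 := one_le_pow₀ (by linarith [four_le_scaleRatio])
    have h4 : (k : ℝ) * (n : ℝ) ^ 3 ≤ n * (n : ℝ) ^ 3 := by
      calc (k : ℝ) * (n : ℝ) ^ 3 = 1 * k * (n : ℝ) ^ 3 := by ring
        _ ≤ scaleRatio ^ 6 * k * (n : ℝ) ^ 3 := by gcongr
        _ ≤ (n : ℝ) ^ 4 := hG.trans h2
        _ = _ := by ring
    exact_mod_cast le_of_mul_le_mul_right h4 (by positivity)
  obtain ⟨h1, h2, h3, h4, h5, h6, -⟩ := ceil_parameters hn hk hkn hd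
  exact containsDisjoint_St4_of_nat G (Fintype.card_fin n) h4 h5 h1 h2 h3 h6 hG

end RGraph

/-! ### Host graphs that restrict unavoidable graphs -/

namespace RGraph

open Classical

variable {r : ℕ} {V W : Type*}

theorem contains_copies_of_containsDisjoint {m : ℕ} {G : RGraph r V} {H : RGraph r W}
    (h : G.ContainsDisjoint m H) : G.Contains (copies m H) := by
  obtain ⟨f, hf, hd⟩ := h
  refine ⟨⟨fun p => f p.1 p.2, ?_⟩, ?_⟩
  · rintro ⟨i, x⟩ ⟨j, y⟩ hxy
    by_cases hij : i = j
    · subst hij; exact congrArg (Prod.mk i) ((f i).injective hxy)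
    · exact (Set.disjoint_left.mp (hd hij) ⟨x, rfl⟩ ⟨y, hxy.symm⟩).elim
  · intro e he
    simp only [copies, Finset.mem_biUnion, Finset.mem_univ, true_and, Finset.mem_image] at he
    obtain ⟨i, a, ha, rfl⟩ := he
    rw [Finset.map_map]
    exact hf i a ha

theorem card_edges_copies (hr : 0 < r) (m : ℕ) (H : RGraph r W) :
    (copies m H).edges.card = m * H.edges.card := by
  unfold copies
  simp only
  rw [Finset.card_biUnion, Finset.sum_congr rfl fun i _ => Finset.card_image_of_injective _
    (Finset.map_injective _)]
  · simp
  · intro i _ j _ hij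
    rw [Function.onFun, Finset.disjoint_left]
    intro e he he'
    obtain ⟨a, ha, rfl⟩ := Finset.mem_image.mp he
    obtain ⟨b, -, hab⟩ := Finset.mem_image.mp he'
    obtain ⟨x, hx⟩ := Finset.card_pos.mp ((H.uniform a ha).symm ▸ hr)
    have : (i, x) ∈ a.map ⟨Prod.mk i, Prod.mk_right_injective i⟩ := Finset.mem_map_of_mem _ hx
    rw [← hab] at this
    obtain ⟨y, -, hy⟩ := Finset.mem_map.mp this
    exact hij (congrArg Prod.fst hy).symm

theorem card_edges_genStar (ds : List ℕ) : (genStar ds).edges.card = ds.prod := by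
  induction ds with
  | nil => simp [genStar]
  | cons d ds ih =>
    rw [genStar, cone]
    simp only [Finset.card_map]
    rw [card_edges_copies (Nat.succ_pos _), ih, List.prod_cons]

/-- The vertices of `H` that lie in an edge. -/
noncomputable def support (H : RGraph r W) : Finset W := H.edges.biUnion id

theorem mem_support {H : RGraph r W} {x : W} : x ∈ H.support ↔ ∃ e ∈ H.edges, x ∈ e := by
  simp [support]

/-- The `r`-graph of all `r`-sets with a given property. -/
noncomputable def ofPred (r : ℕ) [Fintype V] (p : Finset V → Prop) : RGraph r V where
  edges := (Finset.powersetCard r Finset.univ).filter p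
  uniform _ he := (Finset.mem_powersetCard.mp (Finset.mem_filter.mp he).1).2

theorem mem_ofPred [Fintype V] {p : Finset V → Prop} {e : Finset V} :
    e ∈ (ofPred r p).edges ↔ e.card = r ∧ p e := by
  simp [ofPred, Finset.mem_powersetCard]

theorem card_edges_ofPred [Fintype V] (p : Finset V → Prop) [DecidablePred p] :
    (ofPred r p).edges.card = ((Finset.powersetCard r Finset.univ).filter p).card := by
  congr 1
  ext s
  rw [mem_ofPred, Finset.mem_filter, Finset.mem_powersetCard]
  simp

theorem IsUnavoidable.contains {n e : ℕ} {H : RGraph r W} (h : IsUnavoidable n e H)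
    (G : RGraph r (Fin n)) (hG : e ≤ G.edges.card) : G.Contains H := by
  obtain ⟨E, hE, hc⟩ := Finset.exists_subset_card_eq hG
  obtain ⟨f, hf⟩ := h ⟨E, fun x hx => G.uniform x (hE hx)⟩ hc
  exact ⟨f, fun x hx => hE (hf x hx)⟩

theorem card_edges_le_of_isCopy {G : RGraph r V} {H : RGraph r W} {f : W ↪ V}
    (hf : IsCopy H G f) : H.edges.card ≤ G.edges.card :=
  Finset.card_le_card_of_injOn (fun e => e.map f) hf (Finset.map_injective f).injOn

variable {n e : ℕ} {H : RGraph 4 W}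

theorem IsUnavoidable.card_support_le_of_clique (h : IsUnavoidable n e H) {m : ℕ} (hm : m ≤ n)
    (he : e ≤ m.choose 4) : H.support.card ≤ m := by
  set A : Finset (Fin n) := Finset.univ.filter fun i => i.val < m with hA
  have hAc : A.card = m := by
    rw [hA, Fin.card_filter_val_lt]; exact min_eq_right hm
  obtain ⟨f, hf⟩ := h.contains (ofPred 4 fun s => s ⊆ A) (by
    refine he.trans ?_
    rw [← hAc, ← Finset.card_powersetCard]
    refine Finset.card_le_card fun s hs => ?_
    obtain ⟨h1, h2⟩ := Finset.mem_powersetCard.mp hs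
    exact mem_ofPred.mpr ⟨h2, h1⟩)
  rw [← hAc]
  refine Finset.card_le_card_of_injOn f (fun x hx => ?_) f.injective.injOn
  obtain ⟨s, hs, hxs⟩ := mem_support.mp hx
  exact (mem_ofPred.mp (hf s hs)).2 (Finset.mem_map_of_mem _ hxs)

theorem choose_four_add_le (j a : ℕ) : j.choose 4 + a * j.choose 3 ≤ (j + a).choose 4 := by
  induction a with
  | zero => simp
  | succ a ih =>
    rw [← add_assoc]
    have e : (j + a + 1).choose 4 = (j + a).choose 3 + (j + a).choose 4 :=
      Nat.choose_succ_succ' _ 3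
    have := Nat.choose_le_choose 3 (Nat.le_add_right j a)
    rw [add_mul, one_mul]
    omega

/-- The number of `4`-sets that meet a given set. -/
theorem le_card_meeting {a : ℕ} (ha : a ≤ n) :
    a * (n - a).choose 3 ≤
      (ofPred (V := Fin n) 4 fun s => ∃ i ∈ s, i.val < a).edges.card := by
  have h1 := Finset.card_filter_add_card_filter_not
    (s := Finset.powersetCard 4 (Finset.univ : Finset (Fin n))) (fun s => ∃ i ∈ s, i.val < a)
  have h2 : (Finset.powersetCard 4 (Finset.univ : Finset (Fin n))).filter
      (fun s => ¬ ∃ i ∈ s, i.val < a) ⊆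
      Finset.powersetCard 4 (Finset.univ.filter fun i : Fin n => ¬ i.val < a) := by
    intro s hs
    obtain ⟨h1, h2⟩ := Finset.mem_filter.mp hs
    refine Finset.mem_powersetCard.mpr ⟨fun i hi => ?_, (Finset.mem_powersetCard.mp h1).2⟩
    push Not at h2
    simpa using h2 i hi
  have h3 := Finset.card_le_card h2
  have h4 := Finset.card_filter_add_card_filter_not (s := (Finset.univ : Finset (Fin n)))
    (fun i => i.val < a)
  rw [Fin.card_filter_val_lt, min_eq_right ha, Finset.card_univ, Fintype.card_fin] at h4
  rw [Finset.card_powersetCard, show (Finset.univ.filter fun i : Fin n => ¬ i.val < a).card = n - a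
    by omega] at h3
  rw [Finset.card_powersetCard, Finset.card_univ, Fintype.card_fin] at h1
  have h5 := choose_four_add_le (n - a) a
  rw [Nat.sub_add_cancel ha] at h5
  rw [card_edges_ofPred]
  omega

theorem card_block_le {m : ℕ} (hm : 0 < m) (j : ℕ) :
    (Finset.univ.filter fun i : Fin n => i.val / m = j).card ≤ m := by
  have : (Finset.univ.filter fun i : Fin n => i.val / m = j).card ≤
      (Finset.Ico (j * m) (j * m + m)).card := by
    refine Finset.card_le_card_of_injOn Fin.val (fun i hi => ?_) Fin.val_injective.injOn
    simp only [Finset.coe_filter, Finset.mem_univ, true_and, Set.mem_ofPred_eq] at hi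
    rw [Finset.coe_Ico, Set.mem_Ico]
    have := (Nat.div_eq_iff hm).mp hi
    omega
  simpa using this

theorem card_block_eq {m j : ℕ} (hm : 0 < m) (hj : j < n / m) :
    m ≤ (Finset.univ.filter fun i : Fin n => i.val / m = j).card := by
  have hjm : (j + 1) * m ≤ n := (Nat.le_div_iff_mul_le hm).mp hj
  rw [add_mul, one_mul] at hjm
  have : (Finset.univ : Finset (Fin m)).card ≤
      (Finset.univ.filter fun i : Fin n => i.val / m = j).card := by
    refine Finset.card_le_card_of_injOn (fun i => ⟨j * m + i.val, by omega⟩) (fun i _ => ?_) ?_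
    · simp only [Finset.coe_filter, Finset.mem_univ, true_and, Set.mem_ofPred_eq]
      rw [mul_comm, Nat.mul_add_div hm, Nat.div_eq_of_lt i.2, add_zero]
    · intro i _ i' _ h
      simp only [Fin.mk.injEq] at h
      exact Fin.ext (by omega)
  simpa using this

/-- The number of `4`-sets inside the blocks of an equipartition. -/
theorem le_card_blocks {m : ℕ} (hm : 0 < m) :
    n / m * m.choose 4 ≤
      (ofPred (V := Fin n) 4 fun s => ∀ i ∈ s, ∀ j ∈ s, i.val / m = j.val / m).edges.card := by
  set B : ℕ → Finset (Fin n) := fun j => Finset.univ.filter fun i : Fin n => i.val / m = j with hB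
  have hmem : ∀ j s, s ∈ Finset.powersetCard 4 (B j) → s.card = 4 ∧ ∀ i ∈ s, i.val / m = j := by
    intro j s hs
    obtain ⟨h1, h2⟩ := Finset.mem_powersetCard.mp hs
    exact ⟨h2, fun i hi => (Finset.mem_filter.mp (h1 hi)).2⟩
  have hsub : (Finset.range (n / m)).biUnion (fun j => Finset.powersetCard 4 (B j)) ⊆
      (ofPred (V := Fin n) 4 fun s => ∀ i ∈ s, ∀ j ∈ s, i.val / m = j.val / m).edges := by
    intro s hs
    obtain ⟨j, -, hs⟩ := Finset.mem_biUnion.mp hs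
    obtain ⟨h1, h2⟩ := hmem j s hs
    exact mem_ofPred.mpr ⟨h1, fun i hi i' hi' => (h2 i hi).trans (h2 i' hi').symm⟩
  refine le_trans ?_ (Finset.card_le_card hsub)
  rw [Finset.card_biUnion]
  · refine le_trans ?_ (Finset.card_nsmul_le_sum _ _ (m.choose 4) fun j hj => ?_)
    · simp
    · rw [Finset.card_powersetCard]
      exact Nat.choose_le_choose 4 (card_block_eq hm (Finset.mem_range.mp hj))
  · intro j _ j' _ hjj
    rw [Function.onFun, Finset.disjoint_left]
    intro s hs hs'
    obtain ⟨h1, h2⟩ := hmem j s hs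
    obtain ⟨i, hi⟩ := Finset.card_pos.mp (h1 ▸ (by norm_num : 0 < 4))
    exact hjj ((h2 i hi).symm.trans ((hmem j' s hs').2 i hi))

/-- One host consists of all 4-sets meeting a fixed a-set, so H has a vertex cover of size at most
a. The other is a union of disjoint m-cliques. Every non-isolated vertex of H shares an edge, hence
a clique, with a cover vertex. -/
theorem IsUnavoidable.card_support_le_mul [Fintype W] (h : IsUnavoidable n e H) {a m : ℕ}
    (ha : a ≤ n)
    (hm : 0 < m) (h1 : e ≤ a * (n - a).choose 3) (h2 : e ≤ n / m * m.choose 4) :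
    H.support.card ≤ a * m := by
  obtain ⟨f, hf⟩ := h.contains _ (h1.trans (le_card_meeting ha))
  obtain ⟨g, hg⟩ := h.contains _ (h2.trans (le_card_blocks hm))
  set A : Finset W := Finset.univ.filter fun x => (f x).val < a with hA
  have hAc : A.card ≤ a := by
    have : A.card ≤ (Finset.univ.filter fun i : Fin n => i.val < a).card :=
      Finset.card_le_card_of_injOn f (fun x hx => by simpa [hA] using hx) f.injective.injOn
    rw [Fin.card_filter_val_lt] at this
    exact this.trans (min_le_right _ _)
  have hsub : H.support ⊆ A.biUnion fun z =>
      Finset.univ.filter fun x => (g x).val / m = (g z).val / m := by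
    intro x hx
    obtain ⟨s, hs, hxs⟩ := mem_support.mp hx
    obtain ⟨i, hi, hia⟩ := (mem_ofPred.mp (hf s hs)).2
    obtain ⟨z, hz, rfl⟩ := Finset.mem_map.mp hi
    refine Finset.mem_biUnion.mpr ⟨z, Finset.mem_filter.mpr ⟨Finset.mem_univ _, hia⟩,
      Finset.mem_filter.mpr ⟨Finset.mem_univ _, ?_⟩⟩
    exact (mem_ofPred.mp (hg s hs)).2 _ (Finset.mem_map_of_mem _ hxs) _ (Finset.mem_map_of_mem _ hz)
  refine (Finset.card_le_card hsub).trans (Finset.card_biUnion_le.trans ?_)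
  refine (Finset.sum_le_card_nsmul _ _ m fun z _ => ?_).trans ?_
  · refine le_trans ?_ (card_block_le (n := n) hm ((g z).val / m))
    exact Finset.card_le_card_of_injOn g (fun x hx => by simpa using hx) g.injective.injOn
  · rw [smul_eq_mul]
    exact Nat.mul_le_mul_right _ hAc

theorem card_colourings_mul_pow {X : Type*} [Fintype X] [DecidableEq X] (q : ℕ) (S : Finset X) (i : Fin q)
    [DecidablePred fun c : X → Fin q => ∀ s ∈ S, c s = i] :
    (Finset.univ.filter fun c : X → Fin q => ∀ s ∈ S, c s = i).card * q ^ S.card =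
      q ^ Fintype.card X := by
  have : (Finset.univ.filter fun c : X → Fin q => ∀ s ∈ S, c s = i) =
      Fintype.piFinset fun s => if s ∈ S then {i} else Finset.univ := by
    ext c
    simp only [Finset.mem_filter, Finset.mem_univ, true_and, Fintype.mem_piFinset]
    refine forall_congr' fun s => ?_
    split_ifs with hs <;> simp [hs]
  rw [this, Fintype.card_piFinset]
  have h2 : ∀ s : X, (if s ∈ S then ({i} : Finset (Fin q)) else Finset.univ).card =
      if s ∈ S then 1 else q := by
    intro s; split_ifs <;> simp
  simp only [h2]
  rw [Finset.prod_ite, Finset.prod_const_one, one_mul, Finset.prod_const, ← pow_add]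
  congr 1
  have := Finset.card_filter_add_card_filter_not (s := (Finset.univ : Finset X)) (fun s => s ∈ S)
  rw [Finset.card_univ] at this
  rw [← this, add_comm]
  congr 2
  ext; simp

/-- Every q-colouring of the 4-sets has a colour class of at least e sets, hence a monochromatic
copy of H. A fixed placement of H is monochromatic in a given colour for a proportion q^(-|E(H)|) of
colourings, and the union bound runs over q colours and at most n^|support| placements. -/
theorem IsUnavoidable.pow_card_edges_le (h : IsUnavoidable n e H) {q : ℕ} (hq : 0 < q)
    (hqe : q * e ≤ n.choose 4) :
    q ^ H.edges.card ≤ q * n ^ H.support.card := by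
  -- Placements are recorded on the support only, so that isolated vertices of H do not enter the
  -- exponent.
  set img : (H.support → Fin n) → Finset W → Finset (Fin n) := fun φ s =>
    (Finset.univ.filter fun x : H.support => x.val ∈ s).image φ with himg
  set Φ : Finset (H.support → Fin n) := Finset.univ.filter fun φ => Function.Injective φ with hΦ
  have hcard : ∀ φ ∈ Φ, (H.edges.image (img φ)).card = H.edges.card := by
    intro φ hφ
    have hφ := (Finset.mem_filter.mp hφ).2
    refine Finset.card_image_of_injOn fun s hs t ht hst => ?_
    have key : ∀ s ∈ H.edges, ∀ x (hx : x ∈ H.support), x ∈ s ↔ φ ⟨x, hx⟩ ∈ img φ s := by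
      intro s _ x hx
      simp only [himg, Finset.mem_image, Finset.mem_filter, Finset.mem_univ, true_and]
      constructor
      · intro h; exact ⟨⟨x, hx⟩, h, rfl⟩
      · rintro ⟨y, hy, hyx⟩
        rw [hφ hyx] at hy; exact hy
    ext x
    constructor
    · intro hx
      have hx' := mem_support.mpr ⟨s, hs, hx⟩
      have hst' : img φ s = img φ t := hst
      rw [key t ht x hx', ← hst', ← key s hs x hx']; exact hx
    · intro hx
      have hx' := mem_support.mpr ⟨t, ht, hx⟩
      have hst' : img φ s = img φ t := hst
      rw [key s hs x hx', hst', ← key t ht x hx']; exact hx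
  set col : (H.support → Fin n) × Fin q → Finset (Finset (Fin n) → Fin q) := fun p =>
    Finset.univ.filter fun c => ∀ s ∈ H.edges.image (img p.1), c s = p.2 with hcol
  have hcov : (Finset.univ : Finset (Finset (Fin n) → Fin q)) ⊆
      (Φ ×ˢ Finset.univ).biUnion col := by
    intro c _
    obtain ⟨i, -, hi⟩ := Finset.exists_le_card_fiber_of_mul_le_card_of_maps_to
      (s := Finset.powersetCard 4 (Finset.univ : Finset (Fin n))) (t := (Finset.univ : Finset (Fin q)))
      (f := c) (n := e) (fun _ _ => Finset.mem_univ _) ⟨⟨0, hq⟩, Finset.mem_univ _⟩ (by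
        rw [Finset.card_powersetCard, Finset.card_univ, Finset.card_univ, Fintype.card_fin,
          Fintype.card_fin]
        exact hqe)
    obtain ⟨f, hf⟩ := h.contains (ofPred 4 fun s => c s = i) (by rw [card_edges_ofPred]; exact hi)
    refine Finset.mem_biUnion.mpr ⟨(fun x => f x.val, i), ?_, ?_⟩
    · refine Finset.mem_product.mpr ⟨Finset.mem_filter.mpr ⟨Finset.mem_univ _, ?_⟩,
        Finset.mem_univ _⟩
      exact f.injective.comp Subtype.val_injective
    · refine Finset.mem_filter.mpr ⟨Finset.mem_univ _, fun s hs => ?_⟩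
      obtain ⟨a, ha, rfl⟩ := Finset.mem_image.mp hs
      have : img (fun x => f x.val) a = a.map f := by
        ext y
        simp only [himg, Finset.mem_image, Finset.mem_filter, Finset.mem_univ, true_and,
          Finset.mem_map]
        constructor
        · rintro ⟨x, hx, rfl⟩; exact ⟨x, hx, rfl⟩
        · rintro ⟨x, hx, rfl⟩; exact ⟨⟨x, mem_support.mpr ⟨a, ha, hx⟩⟩, hx, rfl⟩
      rw [this]
      exact (mem_ofPred.mp (hf a ha)).2
  have h0 : Fintype.card (Finset (Fin n) → Fin q) = q ^ Fintype.card (Finset (Fin n)) := by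
    rw [Fintype.card_fun, Fintype.card_fin]
  have h1 := (Finset.card_le_card hcov).trans Finset.card_biUnion_le
  rw [Finset.card_univ, h0] at h1
  have h2 := Nat.mul_le_mul_right (q ^ H.edges.card) h1
  rw [Finset.sum_mul] at h2
  have h3 : ∀ p ∈ Φ ×ˢ (Finset.univ : Finset (Fin q)), (col p).card * q ^ H.edges.card =
      q ^ Fintype.card (Finset (Fin n)) := by
    intro p hp
    rw [← hcard p.1 (Finset.mem_product.mp hp).1]
    convert card_colourings_mul_pow q (H.edges.image (img p.1)) p.2
  rw [Finset.sum_congr rfl h3, Finset.sum_const, smul_eq_mul, Finset.card_product,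
    Finset.card_univ, Fintype.card_fin] at h2
  generalize Fintype.card (Finset (Fin n)) = M at h2
  rw [mul_comm] at h2
  have h4 := Nat.le_of_mul_le_mul_right h2 (pow_pos hq M)
  refine h4.trans ?_
  rw [mul_comm]
  refine Nat.mul_le_mul_left _ ((Finset.card_filter_le _ _).trans ?_)
  simp

end RGraph

/-! ### Bounds on the vertices and edges of unavoidable graphs -/

namespace RGraph

theorem cube_le_choose_three {x : ℕ} (hx : 8 ≤ x) : x ^ 3 ≤ 12 * x.choose 3 := by
  obtain ⟨y, rfl⟩ := Nat.exists_eq_add_of_le hx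
  have h := Nat.descFactorial_eq_factorial_mul_choose (8 + y) 3
  simp only [Nat.descFactorial, Nat.factorial] at h
  have e0 : 8 + y - 0 = 8 + y := rfl
  have e1 : 8 + y - 1 = 7 + y := by omega
  have e2 : 8 + y - 2 = 6 + y := by omega
  rw [e0, e1, e2] at h
  nlinarith

theorem pow_four_le_choose_four {x : ℕ} (hx : 8 ≤ x) : x ^ 4 ≤ 96 * x.choose 4 := by
  obtain ⟨y, rfl⟩ := Nat.exists_eq_add_of_le hx
  have h := Nat.descFactorial_eq_factorial_mul_choose (8 + y) 4
  simp only [Nat.descFactorial, Nat.factorial] at h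
  have e0 : 8 + y - 0 = 8 + y := rfl
  have e1 : 8 + y - 1 = 7 + y := by omega
  have e2 : 8 + y - 2 = 6 + y := by omega
  have e3 : 8 + y - 3 = 5 + y := by omega
  rw [e0, e1, e2, e3] at h
  have : (8 + y) ^ 4 ≤ 4 * ((5 + y) * ((6 + y) * ((7 + y) * ((8 + y) * 1)))) := by
    ring_nf; nlinarith
  nlinarith

theorem complete_card (n : ℕ) :
    (ofPred (V := Fin n) 4 fun _ => True).edges.card = n.choose 4 := by
  rw [card_edges_ofPred, Finset.filter_true, Finset.card_powersetCard, Finset.card_univ,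
    Fintype.card_fin]

variable {W : Type*} {H : RGraph 4 W} {n k e d t c : ℕ}

theorem IsUnavoidable.card_support_le [Fintype W] (h : IsUnavoidable n e H) (hn : 16 ≤ n) (hk : 0 < k)
    (hd : 0 < d) (hnd : n ≤ d ^ 3 * k) (ht : 0 < t)
    (hkt : k ≤ t ∨ n ^ 3 * k ≤ (t * d ^ 2 * k) ^ 4) (hc : 0 < c) (he : e ≤ c * k * n ^ 3)
    (hen : e ≤ n.choose 4) : H.support.card ≤ 2 * 96 * 192 * c ^ 2 * (t * (d ^ 2 * k)) := by
  have hsn : H.support.card ≤ n := by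
    obtain ⟨f, -⟩ := h.contains _ (hen.trans (complete_card n).ge)
    have := Finset.card_le_card_of_injOn (s := H.support) (t := Finset.univ) f
      (fun _ _ => Finset.mem_coe.mpr (Finset.mem_univ _)) f.injective.injOn
    simpa using this
  have hcc : c ≤ c ^ 2 := Nat.le_self_pow (by norm_num) c
  rcases hkt with hkt | hkt
  -- Case t = k: cover size a of order k and cliques of size m of order d^2 k give a · m of order t
  -- d^2 k. If n ≤ 2a or n ≤ m, the trivial bound by n suffices.
  · set m := 192 * c * (d ^ 2 * k) with hm
    have hm8 : 8 ≤ m := by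
      have : 1 ≤ c * (d ^ 2 * k) := Nat.one_le_iff_ne_zero.mpr (by positivity)
      rw [hm, mul_assoc]; omega
    set a := 96 * c * k with ha
    have ha1 : 1 ≤ a := Nat.one_le_iff_ne_zero.mpr (by positivity)
    have hgoal : 2 * (a * m) ≤ 2 * 96 * 192 * c ^ 2 * (t * (d ^ 2 * k)) := by
      calc 2 * (a * m) = 2 * 96 * 192 * c ^ 2 * (k * (d ^ 2 * k)) := by rw [ha, hm]; ring
        _ ≤ _ := by gcongr
    refine le_trans ?_ hgoal
    rcases le_or_gt n (2 * a) with h2a | h2a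
    · calc H.support.card ≤ 2 * a := hsn.trans h2a
        _ ≤ 2 * (a * m) := by nlinarith
    rcases le_or_gt n m with hnm | hnm
    · calc H.support.card ≤ m := hsn.trans hnm
        _ ≤ 2 * (a * m) := by nlinarith
    have := h.card_support_le_mul (a := a) (m := m) (by omega) (by omega) ?_ ?_
    · omega
    · have hx : 8 ≤ n - a := by omega
      have h1 := cube_le_choose_three hx
      have h2 : n ^ 3 ≤ (2 * (n - a)) ^ 3 := Nat.pow_le_pow_left (by omega) 3
      have h3 : n ^ 3 ≤ 96 * (n - a).choose 3 := by
        rw [mul_pow] at h2; omega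
      calc e ≤ c * k * n ^ 3 := he
        _ ≤ c * k * (96 * (n - a).choose 3) := by gcongr
        _ = a * (n - a).choose 3 := by rw [ha]; ring
    · have h1 := pow_four_le_choose_four hm8
      have hdiv : n ≤ 2 * m * (n / m) := by
        have h3 := Nat.div_add_mod n m
        have h4 := Nat.mod_lt n (by omega : 0 < m)
        have h5 : 1 ≤ n / m := (Nat.one_le_div_iff (by omega)).mpr hnm.le
        nlinarith
      -- The cliques have about n m^3 edges in total, so m^3 must dominate n^2 k.
      have hnk : n ^ 2 * k ≤ (d ^ 2 * k) ^ 3 := by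
        calc n ^ 2 * k ≤ (d ^ 3 * k) ^ 2 * k := by gcongr
          _ = _ := by ring
      have hmain : (192 * c) * (k * n ^ 3) * m ≤ 192 * (n / m * m.choose 4) * m := by
        calc (192 * c) * (k * n ^ 3) * m = (192 * c) * (n ^ 2 * k) * n * m := by ring
          _ ≤ (192 * c) ^ 3 * (d ^ 2 * k) ^ 3 * (2 * m * (n / m)) * m := by
              gcongr
              exact Nat.le_self_pow (by norm_num) _
          _ = 2 * (m ^ 4 * (n / m)) * m := by rw [hm]; ring
          _ ≤ 2 * (96 * m.choose 4 * (n / m)) * m := by gcongr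
          _ = _ := by ring
      have h6 := Nat.le_of_mul_le_mul_right hmain (by omega)
      have h7 : c * k * n ^ 3 = c * (k * n ^ 3) := by ring
      rw [mul_assoc 192 c] at h6
      omega
  -- In this case a single clique of order t d^2 k already has enough edges, about m^4 ≥ n^3 k up to
  -- constants.
  · set m := 96 * c * (t * d ^ 2 * k) with hm
    have hm8 : 8 ≤ m := by
      have : 1 ≤ c * (t * d ^ 2 * k) := Nat.one_le_iff_ne_zero.mpr (by positivity)
      rw [hm, mul_assoc]; omega
    have hgoal : m ≤ 2 * 96 * 192 * c ^ 2 * (t * (d ^ 2 * k)) := by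
      calc m = 96 * c * (t * (d ^ 2 * k)) := by rw [hm]; ring
        _ ≤ _ := by gcongr; omega
    refine le_trans ?_ hgoal
    rcases le_or_gt n m with hnm | hnm
    · exact hsn.trans hnm
    refine h.card_support_le_of_clique hnm.le ?_
    have h1 := pow_four_le_choose_four hm8
    have h2 : (96 * c) * (n ^ 3 * k) ≤ 96 * m.choose 4 := by
      calc (96 * c) * (n ^ 3 * k) ≤ (96 * c) ^ 4 * (t * d ^ 2 * k) ^ 4 := by
            gcongr; exact Nat.le_self_pow (by norm_num) _
        _ = m ^ 4 := by rw [hm]; ring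
        _ ≤ _ := h1
    have h7 : c * k * n ^ 3 = c * (n ^ 3 * k) := by ring
    rw [mul_assoc 96 c] at h2
    omega

/-- Below the density `n ^ (-ε)`, an unavoidable graph has few edges per vertex. -/
theorem IsUnavoidable.card_edges_le {ε : ℝ} (hε : 0 < ε) (h : IsUnavoidable n e H) (hn : 16 ≤ n)
    (he0 : 0 < e) (hen : e ≤ n.choose 4) (he : (e : ℝ) ≤ (n : ℝ) ^ (4 - ε)) :
    (H.edges.card : ℝ) ≤ 1 + 2 / ε * H.support.card + ((192 : ℝ) ^ (2 / ε)) ^ 4 := by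
  have hn0 : (0 : ℝ) < n := by exact_mod_cast (by omega : 0 < n)
  have hn1 : (1 : ℝ) < n := by exact_mod_cast (by omega : 1 < n)
  have hpos : (0 : ℝ) ≤ 2 / ε * H.support.card := by positivity
  -- For small n the number of edges is at most n^4, which is bounded in terms of ε alone.
  rcases lt_or_ge ((n : ℝ) ^ (ε / 2)) 192 with hsmall | hlarge
  · have h1 : H.edges.card ≤ n ^ 4 := by
      obtain ⟨f, hf⟩ := h.contains _ (hen.trans (complete_card n).ge)
      refine (card_edges_le_of_isCopy hf).trans ?_
      rw [complete_card]; exact Nat.choose_le_pow _ _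
    have h2 : (n : ℝ) ≤ (192 : ℝ) ^ (2 / ε) := by
      have := Real.rpow_le_rpow (by positivity) hsmall.le (by positivity : 0 ≤ 2 / ε)
      rw [← Real.rpow_mul hn0.le] at this
      have e1 : ε / 2 * (2 / ε) = 1 := by field_simp
      rwa [e1, Real.rpow_one] at this
    have h3 : (H.edges.card : ℝ) ≤ (n : ℝ) ^ 4 := by exact_mod_cast h1
    have h4 : (n : ℝ) ^ 4 ≤ ((192 : ℝ) ^ (2 / ε)) ^ 4 := by gcongr
    linarith
  · set q := n.choose 4 / e with hq
    have hq0 : 1 ≤ q := (Nat.one_le_div_iff he0).mpr hen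
    have hqe : q * e ≤ n.choose 4 := Nat.div_mul_le_self _ _
    have hqe' : n.choose 4 ≤ 2 * (q * e) := by
      have h3 := Nat.div_add_mod (n.choose 4) e
      have h4 := Nat.mod_lt (n.choose 4) he0
      rw [← hq] at h3
      nlinarith
    have hmain := h.pow_card_edges_le hq0 hqe
    have h4 : (n : ℝ) ^ 4 ≤ 192 * (q * e) := by
      have := pow_four_le_choose_four (by omega : 8 ≤ n)
      exact_mod_cast this.trans (by omega)
    -- From n^4 ≤ 192 q e and e ≤ n^(4-ε) one gets n^ε ≤ 192 q; one factor n^(ε/2) ≥ 192 cancels the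
    -- constant.
    have hqn : (n : ℝ) ^ (ε / 2) ≤ q := by
      have e1 : (n : ℝ) ^ 4 = (n : ℝ) ^ (4 - ε) * ((n : ℝ) ^ (ε / 2) * (n : ℝ) ^ (ε / 2)) := by
        rw [← Real.rpow_add hn0, ← Real.rpow_add hn0, ← Real.rpow_natCast]
        congr 1; push_cast; ring
      have e2 : 192 * ((q : ℝ) * e) ≤ (n : ℝ) ^ (4 - ε) * (192 * q) := by
        have : (0 : ℝ) ≤ 192 * q := by positivity
        nlinarith
      have e3 := h4.trans e2
      rw [e1] at e3
      have e4 := le_of_mul_le_mul_left e3 (by positivity)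
      nlinarith
    have hq1 : (1 : ℝ) < q := by linarith
    have hlq : ε / 2 * Real.log n ≤ Real.log q := by
      rw [← Real.log_rpow hn0]
      exact Real.log_le_log (by positivity) hqn
    have hln : 0 < Real.log n := Real.log_pos hn1
    have hlq0 : 0 < Real.log q := Real.log_pos hq1
    have hmain' : (q : ℝ) ^ H.edges.card ≤ q * (n : ℝ) ^ H.support.card := by exact_mod_cast hmain
    have hlog := Real.log_le_log (by positivity) hmain'
    rw [Real.log_pow, Real.log_mul (by positivity) (by positivity), Real.log_pow] at hlog
    have hln2 : Real.log n ≤ 2 / ε * Real.log q := by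
      calc Real.log n = 2 / ε * (ε / 2 * Real.log n) := by field_simp
        _ ≤ _ := by gcongr
    have h5 : (H.edges.card : ℝ) * Real.log q ≤ (1 + 2 / ε * H.support.card) * Real.log q := by
      have : (H.support.card : ℝ) * Real.log n ≤ H.support.card * (2 / ε * Real.log q) := by gcongr
      linarith
    have h6 := le_of_mul_le_mul_right h5 hlq0
    have : (0 : ℝ) ≤ ((192 : ℝ) ^ (2 / ε)) ^ 4 := by positivity
    linarith

end RGraph

/-! ### Combining the two parts -/

theorem mainTheorem6 :
    ∃ C : ℝ, 0 < C ∧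
      (∀ (n k : ℕ) (d : ℝ), 0 < n → 0 < k → d = ((n : ℝ) / k) ^ (1 / 3 : ℝ) →
        ∀ G : RGraph 4 (Fin n), C * k * (n : ℝ) ^ 3 ≤ (G.edges.card : ℝ) →
          G.ContainsDisjoint ⌈min (k : ℝ) (d ^ (1 / 4 : ℝ))⌉₊ (RGraph.St4 ⌈d⌉₊ ⌈d⌉₊ k)) ∧
      (∀ ε : ℝ, 0 < ε → ∀ K : ℝ, ∃ C' : ℝ, 0 < C' ∧
        ∀ (n k e : ℕ) (d : ℝ), 0 < n → 0 < k → d = ((n : ℝ) / k) ^ (1 / 3 : ℝ) →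
          C * k * (n : ℝ) ^ 3 ≤ (e : ℝ) → (e : ℝ) ≤ K * k * (n : ℝ) ^ 3 →
          (e : ℝ) ≤ (n : ℝ) ^ (4 - ε) → e ≤ n.choose 4 →
          RGraph.IsUnavoidable n e
            (RGraph.copies ⌈min (k : ℝ) (d ^ (1 / 4 : ℝ))⌉₊ (RGraph.St4 ⌈d⌉₊ ⌈d⌉₊ k)) ∧
          ∀ (W : Type) [Fintype W] (H : RGraph 4 W), RGraph.IsUnavoidable n e H →
            (H.edges.card : ℝ) ≤ C' *
              ((RGraph.copies ⌈min (k : ℝ) (d ^ (1 / 4 : ℝ))⌉₊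
                (RGraph.St4 ⌈d⌉₊ ⌈d⌉₊ k)).edges.card : ℝ)) := by
  have hP4 := RGraph.four_le_scaleRatio
  refine ⟨RGraph.scaleRatio ^ 6, by positivity,
    fun n k d hn hk hd G hG => RGraph.containsDisjoint_St4 hn hk hd G hG, fun ε hε K => ?_⟩
  set c := ⌈max K 1⌉₊ with hc
  have hc0 : 0 < c := Nat.ceil_pos.mpr (lt_max_of_lt_right one_pos)
  have hKc : K ≤ c := (le_max_left _ _).trans (Nat.le_ceil _)
  refine ⟨1 + 2 / ε * (2 * 96 * 192 * c ^ 2) + ((192 : ℝ) ^ (2 / ε)) ^ 4, by positivity, ?_⟩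
  intro n k e d hn hk hd hCe heK heε hen
  refine ⟨fun G hG => RGraph.contains_copies_of_containsDisjoint
    (RGraph.containsDisjoint_St4 hn hk hd G (by rw [hG]; exact hCe)), ?_⟩
  intro W _ H hH
  have hn' : (0 : ℝ) < n := by exact_mod_cast hn
  have hk' : (0 : ℝ) < k := by exact_mod_cast hk
  -- Comparing C k n^3 ≤ e ≤ n^4 with C ≥ 16 excludes small n, as needed for the binomial estimates.
  have hkn : 16 * k ≤ n := by
    have h1 : e ≤ n ^ 4 := hen.trans (Nat.choose_le_pow _ _)
    have h2 : (e : ℝ) ≤ (n : ℝ) ^ 4 := by exact_mod_cast h1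
    have h3 : 16 ≤ RGraph.scaleRatio ^ 6 := by
      calc (16 : ℝ) ≤ 4 ^ 6 := by norm_num
        _ ≤ _ := by gcongr
    have h4 : ((16 * k : ℕ) : ℝ) * (n : ℝ) ^ 3 ≤ n * (n : ℝ) ^ 3 := by
      calc ((16 * k : ℕ) : ℝ) * (n : ℝ) ^ 3 = 16 * k * (n : ℝ) ^ 3 := by push_cast; ring
        _ ≤ RGraph.scaleRatio ^ 6 * k * (n : ℝ) ^ 3 := by gcongr
        _ ≤ (n : ℝ) ^ 4 := hCe.trans h2
        _ = _ := by ring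
    exact_mod_cast le_of_mul_le_mul_right h4 (by positivity)
  obtain ⟨h1, h2, h3, h4, h5, h6, h7⟩ := RGraph.ceil_parameters hn hk (by omega) hd
  have he0 : 0 < e := by
    have : (0 : ℝ) < e := lt_of_lt_of_le (by positivity) hCe
    exact_mod_cast this
  have hec : e ≤ c * k * n ^ 3 := by
    have : (e : ℝ) ≤ c * k * (n : ℝ) ^ 3 := heK.trans (by gcongr)
    exact_mod_cast this
  have hsupp := hH.card_support_le (by omega) hk h1 h3 h4 h7 hc0 hec hen
  have hedge := hH.card_edges_le hε (by omega) he0 hen heε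
  have hS : (RGraph.copies ⌈min (k : ℝ) (d ^ (1 / 4 : ℝ))⌉₊ (RGraph.St4 ⌈d⌉₊ ⌈d⌉₊ k)).edges.card =
      ⌈min (k : ℝ) (d ^ (1 / 4 : ℝ))⌉₊ * (⌈d⌉₊ ^ 2 * k) := by
    rw [RGraph.card_edges_copies (by norm_num), RGraph.St4,
      show (RGraph.genStar [⌈d⌉₊, ⌈d⌉₊, k]).edges.card = _ from RGraph.card_edges_genStar _]
    simp only [List.prod_cons, List.prod_nil]
    ring
  rw [hS]
  set s := ⌈min (k : ℝ) (d ^ (1 / 4 : ℝ))⌉₊ * (⌈d⌉₊ ^ 2 * k) with hs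
  -- Since S has at least one edge, the additive constants in the edge bound are absorbed into C'.
  have hs1 : (1 : ℝ) ≤ s := by
    have : 0 < s := by positivity
    exact_mod_cast this
  have hsupp' : (H.support.card : ℝ) ≤ 2 * 96 * 192 * c ^ 2 * s := by exact_mod_cast hsupp
  calc (H.edges.card : ℝ) ≤ 1 + 2 / ε * H.support.card + ((192 : ℝ) ^ (2 / ε)) ^ 4 := hedge
    _ ≤ 1 * s + 2 / ε * (2 * 96 * 192 * c ^ 2 * s) + ((192 : ℝ) ^ (2 / ε)) ^ 4 * s := by
        gcongr
        · linarith
        · exact le_mul_of_one_le_right (by positivity) hs1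
    _ = _ := by ring
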